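/- Let $v_p=\pi^{p/2}/\Gamma(p/2+1)$ be the volume of the unit ball of $\mathbb R^p$. There is a function $C(D,d)$, defined for integers $d\ge 2$ and $D>2d^2$, which is strictly increasing in $D$, strictly decreasing in $d$, satisfies $C(D,d)\ge 0.79\sqrt d/2.07^{\,d-1}$, and is given for all $D\ge 15$ by $$C(D,d)=\frac1{2^{d-2}}\,\frac{v_{d-1}}{v_d}\Big(\frac{v_D}{v_{D-1}}\Big)^{\frac{d-1}{D-1}},$$ such that the following holds. Let $n\ge 1$, $D$, $d_1,\dots,d_n$, $s_1,\dots,s_n$ be natural numbers, and put $\rho_i=s_i/d_i$, $p_i=s_i/\sum_j s_j$, $k_i=\frac{D}{2d_i}-d_i$. Assume $2\le d_i<\sqrt{D/2}$ and $\rho_i\ge 1$ for all $i$. Let $S_1,\dots,S_n$ be independent random linear subspaces of $\mathbb R^D$, $S_i$ being uniformly distributed (i.e. rotation invariant) among the subspaces of dimension $d_i$, and let $s_i$ points be sampled independently and uniformly on the unit sphere of each $S_i$, independently for different $i$. Let the dictionary $A$ consist of all $\sum_i s_i$ sampled points; those sampled on $S_i$ form its $i$-th group. Then with probability $$p>1-\sum_{i=1}^n\Big(\frac{d_i2^{d_i}}{C(D,d_i)}\sqrt{\rho_i}\,e^{-C(D,d_i)\sqrt{\rho_i}}+\frac{d_i(2e)^{d_i}}{p_i\,\rho_i^{k_i}}\Big)$$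 every $b\in\bigcup_i S_i$ is classified correctly by sparse representation based classification, both with Basis Pursuit (BP) and with Orthogonal Matching Pursuit (OMP). That is, for all $i$ and all $b\in S_i$: the problem of minimizing $\|x\|_1$ subject to $Ax=b$ has a solution, and all its solutions $x$ have their nonzero entries in the $i$-th group; and OMP (start with no chosen atom; while the component $r$ of $b$ orthogonal to the chosen atoms is nonzero, add an atom maximizing $|\langle a,r\rangle|$, ties being broken in any way; finally represent $b$ by the chosen atoms) terminates on $b$, and every output has its nonzero entries in the $i$-th group. (More precisely, this event contains a measurable event of probability $p$ as above.) -/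

import Mathlib

open MeasureTheory ProbabilityTheory

noncomputable section

/-! ### Basis pursuit and orthogonal matching pursuit -/

/-- Linear synthesis `A x = ∑ q, x q • a q` for a dictionary `a`, viewed as a family of atoms. -/
def synth {D : ℕ} {J : Type*} [Fintype J] (a : J → EuclideanSpace ℝ (Fin D)) (x : J → ℝ) :
    EuclideanSpace ℝ (Fin D) :=
  ∑ q, x q • a q

/-- `x` is a solution of basis pursuit: a minimizer of the `ℓ¹` norm among all representations
of `b` in the dictionary `a`. -/
def IsBPSolution {D : ℕ} {J : Type*} [Fintype J] (a : J → EuclideanSpace ℝ (Fin D))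
    (b : EuclideanSpace ℝ (Fin D)) (x : J → ℝ) : Prop :=
  synth a x = b ∧ ∀ y : J → ℝ, synth a y = b → ∑ q, |x q| ≤ ∑ q, |y q|

/-- The residual of OMP after the atoms indexed by `W` have been chosen: the component of `b`
orthogonal to the span of these atoms. -/
def ompResidual {D : ℕ} {J : Type*} (a : J → EuclideanSpace ℝ (Fin D))
    (b : EuclideanSpace ℝ (Fin D)) (W : Finset J) : EuclideanSpace ℝ (Fin D) :=
  b - (Submodule.span ℝ (a '' (W : Set J))).starProjection b

open Classical in
/-- `W 0, W 1, …` are the successive index sets of a run of OMP on the signal `b`. Ties in the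
selection of the atom may be broken in any way. Once the residual vanishes the run has
terminated, and `W` is continued by a constant. -/
def IsOMPRun {D : ℕ} {J : Type*} (a : J → EuclideanSpace ℝ (Fin D))
    (b : EuclideanSpace ℝ (Fin D)) (W : ℕ → Finset J) : Prop :=
  W 0 = ∅ ∧ ∀ k,
    (ompResidual a b (W k) = 0 → W (k + 1) = W k) ∧
    (ompResidual a b (W k) ≠ 0 → ∃ q : J,
      (∀ q' : J, |inner ℝ (a q') (ompResidual a b (W k))| ≤
        |inner ℝ (a q) (ompResidual a b (W k))|) ∧
      W (k + 1) = insert q (W k))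

/-- OMP terminates on `b`: every run reaches a vanishing residual. -/
def OMPTerminates {D : ℕ} {J : Type*} (a : J → EuclideanSpace ℝ (Fin D))
    (b : EuclideanSpace ℝ (Fin D)) : Prop :=
  ∀ W : ℕ → Finset J, IsOMPRun a b W → ∃ k, ompResidual a b (W k) = 0

/-- `x` is an output of OMP: a representation of `b` by the atoms chosen by a terminated run. -/
def IsOMPSolution {D : ℕ} {J : Type*} [Fintype J] (a : J → EuclideanSpace ℝ (Fin D))
    (b : EuclideanSpace ℝ (Fin D)) (x : J → ℝ) : Prop :=
  ∃ (W : ℕ → Finset J) (k : ℕ), IsOMPRun a b W ∧ ompResidual a b (W k) = 0 ∧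
    (∀ q, q ∉ W k → x q = 0) ∧ synth a x = b

/-! ### Sparse representation based classification -/

/-- The coefficient vector `x` over the grouped dictionary (the `i`-th group has `s i` atoms) is
subspace-sparse for the group `i`: only atoms of that group are used. -/
def IsSubspaceSparse {n : ℕ} {s : Fin n → ℕ} (i : Fin n) (x : (Σ i, Fin (s i)) → ℝ) : Prop :=
  ∀ q, x q ≠ 0 → q.1 = i

/-- SRC by BP and SRC by OMP both classify every point `b` of the union of the subspaces `S i`
correctly: whenever `b ∈ S i`, BP has a solution and all its solutions are supported on the
`i`-th group, and OMP terminates and all its solutions are supported on the `i`-th group.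
(A nonzero `b` only has nonzero representations, so its label is then determined, and it lies in
exactly one of the subspaces.) -/
def SRCCorrect {n D : ℕ} {s : Fin n → ℕ} (S : Fin n → Submodule ℝ (EuclideanSpace ℝ (Fin D)))
    (a : (Σ i, Fin (s i)) → EuclideanSpace ℝ (Fin D)) : Prop :=
  ∀ i, ∀ b ∈ S i,
    ((∃ x, IsBPSolution a b x) ∧ ∀ x, IsBPSolution a b x → IsSubspaceSparse i x) ∧
    (OMPTerminates a b ∧ ∀ x, IsOMPSolution a b x → IsSubspaceSparse i x)

/-! ### The random model -/

/-- The Borel σ-algebra on linear subspaces of `ℝ^D`, each identified with the orthogonal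
projection onto it. -/
instance subspaceMeasurableSpace (D : ℕ) :
    MeasurableSpace (Submodule ℝ (EuclideanSpace ℝ (Fin D))) :=
  MeasurableSpace.comap (fun S => S.starProjection)
    (borel (EuclideanSpace ℝ (Fin D) →L[ℝ] EuclideanSpace ℝ (Fin D)))

/-- `μ` is the uniform distribution on the `d`-dimensional linear subspaces of `ℝ^D`: the
probability measure on this Grassmannian that is invariant under all linear isometries. -/
structure IsUniformSubspaceLaw {D : ℕ} (d : ℕ)
    (μ : Measure (Submodule ℝ (EuclideanSpace ℝ (Fin D)))) : Prop where
  isProbabilityMeasure : IsProbabilityMeasure μ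
  finrank_eq : ∀ᵐ S : Submodule ℝ (EuclideanSpace ℝ (Fin D)) ∂μ, Module.finrank ℝ ↥S = d
  invariant : ∀ U : EuclideanSpace ℝ (Fin D) ≃ₗᵢ[ℝ] EuclideanSpace ℝ (Fin D),
    μ.map (fun S => S.map U.toLinearEquiv.toLinearMap) = μ

/-- The uniform distribution on the unit sphere of the subspace `S` (normalized surface measure),
as a measure on the ambient space. -/
def uniformOnSphere {D : ℕ} (S : Submodule ℝ (EuclideanSpace ℝ (Fin D))) :
    Measure (EuclideanSpace ℝ (Fin D)) :=
  (((volume : Measure ↥S).toSphere Set.univ)⁻¹ • (volume : Measure ↥S).toSphere).map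
    (fun x : Metric.sphere (0 : ↥S) 1 => ((x : ↥S) : EuclideanSpace ℝ (Fin D)))

/-- The random subspaces `S i` of dimensions `d i` are independent and uniform, and `a i j`,
`j < s i`, are points sampled independently and uniformly on the unit sphere of `S i`: given
`S i`, they are independent with law `uniformOnSphere (S i)`, and the pairs consisting of a
subspace and its sample are independent for different `i`. -/
structure IsRandomSubspaceModel {n D : ℕ} (d s : Fin n → ℕ) {Ω : Type*} [MeasurableSpace Ω]
    (P : Measure Ω) (S : Fin n → Ω → Submodule ℝ (EuclideanSpace ℝ (Fin D)))
    (a : (i : Fin n) → Fin (s i) → Ω → EuclideanSpace ℝ (Fin D)) : Prop where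
  measurable_subspace : ∀ i, Measurable (S i)
  measurable_point : ∀ i j, Measurable (a i j)
  uniform_subspace : ∀ i, IsUniformSubspaceLaw (d i) (P.map (S i))
  uniform_points : ∀ i, ∀ B : Set (Submodule ℝ (EuclideanSpace ℝ (Fin D))), MeasurableSet B →
    ∀ A : Fin (s i) → Set (EuclideanSpace ℝ (Fin D)), (∀ j, MeasurableSet (A j)) →
      P {ω | S i ω ∈ B ∧ ∀ j, a i j ω ∈ A j} =
        ∫⁻ ω in S i ⁻¹' B, ∏ j, uniformOnSphere (S i ω) (A j) ∂P
  indep : iIndepFun (fun i ω => (S i ω, fun j => a i j ω)) P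

/-! ### The constant -/

/-- The volume `v_p` of the unit ball of `ℝ^p`. -/
def unitBallVol (p : ℕ) : ℝ := Real.pi ^ ((p : ℝ) / 2) / Real.Gamma ((p : ℝ) / 2 + 1)

/-- `C(D, d) = 2^{-(d-2)} (v_{d-1} / v_d) (v_D / v_{D-1})^{(d-1)/(D-1)}`, for `2 ≤ d ≤ D`. -/
def srcConst (D d : ℕ) : ℝ :=
  1 / 2 ^ (d - 2) * (unitBallVol (d - 1) / unitBallVol d) *
    (unitBallVol D / unitBallVol (D - 1)) ^ (((d : ℝ) - 1) / ((D : ℝ) - 1))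

end

/-!
Both methods classify every point of `S i` correctly as soon as, for some `t > 0`, each `w ∈ S i`
satisfies `t * ‖w‖ ≤ |⟪a, w⟫|` for some atom `a` of the `i`-th group, while the atoms of the other
groups have a projection to `S i` shorter than `t` (`srcCorrect_of_inradius`). For OMP this is
immediate, as the residual stays in `S i`. For BP, by polar duality the symmetric convex hull of the
`i`-th group contains the ball of radius `t` of `S i`, so the projection of a foreign atom is a
combination of atoms of the `i`-th group of `ℓ¹` norm less than one, and replacing the foreign atoms
by these combinations decreases the objective.

The level is `t = cos θ` with `sin θ = ρ ^ (-1 / (2 * (d - 1)))` (`exists_angle`). It fails for one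
of two reasons.

* Some `w ∈ S i` is at an angle of more than `θ` from the lines of all atoms of its group. Then all
  directions within `θ / 4` of `w` are at an angle of more than `3 θ / 4` from these lines. Take the
  projection to `S i` of a uniform point of the unit ball as a random direction. Markov's inequality
  bounds the failure probability by the probability that such a direction is avoided by all atoms,
  divided by the area of the cap of angle `θ / 4`
  (`IsSphereSample.measure_exists_direction_le`). The area of a cap is at least the relative volume
  of the flat cone inscribed in it (`le_volume_doubleCone`), which is where the ratio
  `v_{d-1} / v_d` in the constant comes from. The result is at most half of the first term.

* A foreign atom has a projection to `S i` of length at least `cos θ`. As `S i` is independent of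
  this atom and rotation invariant, the atom may be replaced by a uniform point of the unit ball, and
  the probability is estimated by comparing products of balls in `S i` and its complement
  (`IsUniformSubspaceLaw.measure_le_norm_starProjection_le`). The estimate exceeds `ρ ^ (-(k + 1))`
  by a factor that grows with `D` when `ρ` is close to `1`; but the bound is trivial unless its first
  terms are at most `1`, and then `ρ ≥ exp (d / 2)` (`half_le_log_of_term_le_one`), which makes the
  estimate fit (`log_estimate`).

The properties of the constant follow from the logarithmic convexity of the Gamma function and from
`(v_p / v_{p-1})² ≤ 2π / (p + 1/2)` (`ballRatio_sq_le`).
-/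

/-! ### A deterministic criterion for subspace-sparse recovery -/

section Deterministic

variable {D : ℕ} {J : Type*}

theorem synth_add [Fintype J] (a : J → EuclideanSpace ℝ (Fin D)) (x y : J → ℝ) :
    synth a (x + y) = synth a x + synth a y := by
  simp [synth, add_smul, Finset.sum_add_distrib]

theorem synth_smul [Fintype J] (a : J → EuclideanSpace ℝ (Fin D)) (c : ℝ) (x : J → ℝ) :
    synth a (c • x) = c • synth a x := by
  simp [synth, mul_smul, Finset.smul_sum]

theorem synth_sum [Fintype J] {ι : Type*} (a : J → EuclideanSpace ℝ (Fin D)) (s : Finset ι)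
    (x : ι → J → ℝ) : synth a (∑ i ∈ s, x i) = ∑ i ∈ s, synth a (x i) := by
  simp only [synth, Finset.sum_apply, Finset.sum_smul]
  exact Finset.sum_comm

theorem synth_single [Fintype J] [DecidableEq J] (a : J → EuclideanSpace ℝ (Fin D)) (q : J)
    (c : ℝ) : synth a (Pi.single q c) = c • a q := by
  simp [synth, Pi.single_apply, ite_smul]

theorem continuous_synth [Fintype J] (a : J → EuclideanSpace ℝ (Fin D)) :
    Continuous (synth a) := by
  unfold synth; fun_prop

theorem isCompact_l1Ball [Fintype J] (R : ℝ) : IsCompact {x : J → ℝ | ∑ q, |x q| ≤ R} := by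
  refine Metric.isCompact_of_isClosed_isBounded
    (isClosed_le (by fun_prop) continuous_const) ?_
  refine Metric.isBounded_closedBall (x := (0 : J → ℝ)) (r := max R 0) |>.subset fun x hx => ?_
  rw [mem_closedBall_zero_iff, pi_norm_le_iff_of_nonneg (le_max_right _ _)]
  intro q
  refine le_trans ?_ (le_trans (hx : ∑ q, |x q| ≤ R) (le_max_left _ _))
  exact Finset.single_le_sum (f := fun q => |x q|) (fun _ _ => abs_nonneg _) (Finset.mem_univ q)

/-- A representable signal has a representation of least `ℓ¹` norm. -/
theorem exists_isBPSolution [Fintype J] (a : J → EuclideanSpace ℝ (Fin D))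
    {b : EuclideanSpace ℝ (Fin D)} (h : ∃ x, synth a x = b) : ∃ x, IsBPSolution a b x := by
  obtain ⟨x₀, hx₀⟩ := h
  have hc : IsCompact ({x : J → ℝ | ∑ q, |x q| ≤ ∑ q, |x₀ q|} ∩ {x | synth a x = b}) :=
    (isCompact_l1Ball _).inter_right (isClosed_eq (continuous_synth a) continuous_const)
  obtain ⟨x, hx, hmin⟩ := hc.exists_isMinOn ⟨x₀, le_refl (∑ q, |x₀ q|), hx₀⟩
    (f := fun x : J → ℝ => ∑ q, |x q|) (Continuous.continuousOn (by fun_prop))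
  refine ⟨x, hx.2, fun y hy => ?_⟩
  by_cases h : ∑ q, |y q| ≤ ∑ q, |x₀ q|
  · exact hmin ⟨h, hy⟩
  · exact le_trans hx.1 (le_of_not_ge h)

variable {V : Submodule ℝ (EuclideanSpace ℝ (Fin D))} {G : Set J} {t : ℝ}
  {a : J → EuclideanSpace ℝ (Fin D)}

theorem inner_starProjection_of_mem {v : EuclideanSpace ℝ (Fin D)} (hv : v ∈ V)
    (w : EuclideanSpace ℝ (Fin D)) : inner ℝ v (V.starProjection w) = inner ℝ v w := by
  rw [← V.inner_starProjection_left_eq_right, V.starProjection_eq_self_iff.2 hv]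

/-- Polar duality: if the atoms of `G` see every direction of `V` at level `t`, then their
symmetric convex hull contains the ball of radius `t` of `V`; hence each `v ∈ V` has a
representation by atoms of `G` of `ℓ¹` norm at most `‖v‖ / t`. -/
theorem exists_synth_eq_of_forall_le_abs_inner [Fintype J] (ht : 0 < t)
    (hin : ∀ w ∈ V, ∃ q ∈ G, t * ‖w‖ ≤ |inner ℝ (a q) w|) (hV : ∀ q ∈ G, a q ∈ V)
    {v : EuclideanSpace ℝ (Fin D)} (hv : v ∈ V) :
    ∃ x : J → ℝ, synth a x = v ∧ t * ∑ q, |x q| ≤ ‖v‖ ∧ ∀ q ∉ G, x q = 0 := by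
  classical
  rcases eq_or_ne v 0 with rfl | hv0
  · exact ⟨0, by simp [synth], by simp, by simp⟩
  have hvn : 0 < ‖v‖ := norm_pos_iff.2 hv0
  set K : Set (J → ℝ) := {x | ∑ q, |x q| ≤ 1} ∩ {x | ∀ q ∉ G, x q = 0} with hK
  have hKc : IsCompact K := by
    refine (isCompact_l1Ball 1).inter_right ?_
    simp only [Set.ofPred_forall]
    exact isClosed_iInter fun q => isClosed_iInter fun _ =>
      isClosed_eq (continuous_apply q) continuous_const
  have hKconv : Convex ℝ K := by
    intro x hx y hy α β hα hβ hαβ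
    refine ⟨?_, fun q hq => by simp [hx.2 q hq, hy.2 q hq]⟩
    have hx1 : ∑ q, |x q| ≤ 1 := hx.1
    have hy1 : ∑ q, |y q| ≤ 1 := hy.1
    calc ∑ q, |(α • x + β • y) q| ≤ ∑ q, (α * |x q| + β * |y q|) := by
          refine Finset.sum_le_sum fun q _ => ?_
          simpa [abs_mul, abs_of_nonneg hα, abs_of_nonneg hβ] using
            abs_add_le (α * x q) (β * y q)
      _ = α * ∑ q, |x q| + β * ∑ q, |y q| := by
          rw [Finset.sum_add_distrib, Finset.mul_sum, Finset.mul_sum]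
      _ ≤ 1 := by nlinarith
  have hIconv : Convex ℝ (synth a '' K) := by
    rintro _ ⟨x, hx, rfl⟩ _ ⟨y, hy, rfl⟩ α β hα hβ hαβ
    exact ⟨α • x + β • y, hKconv hx hy hα hβ hαβ, by rw [synth_add, synth_smul, synth_smul]⟩
  have hmem : (t / ‖v‖) • v ∈ synth a '' K := by
    by_contra hnot
    obtain ⟨f, u, hfu, hu⟩ := geometric_hahn_banach_closed_point hIconv
      (hKc.image (continuous_synth a)).isClosed hnot
    obtain ⟨w, rfl⟩ := (InnerProductSpace.toDual ℝ (EuclideanSpace ℝ (Fin D))).surjective f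
    simp only [InnerProductSpace.toDual_apply_apply] at hfu hu
    obtain ⟨q, hq, hle⟩ := hin _ (V.starProjection_apply_mem w)
    rw [inner_starProjection_of_mem (hV q hq)] at hle
    have key : ∀ c : ℝ, |c| ≤ 1 → c * inner ℝ (a q) w < u := by
      intro c hc
      have hm : Pi.single q c ∈ K := by
        refine ⟨?_, fun r hr => ?_⟩
        · simpa [Pi.single_apply, apply_ite abs] using hc
        · exact Pi.single_eq_of_ne (M := fun _ => ℝ) (fun h : r = q => hr (h.symm ▸ hq)) c
      have := hfu _ ⟨_, hm, rfl⟩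
      rwa [synth_single, inner_smul_right, real_inner_comm] at this
    have h1 : |inner ℝ (a q) w| < u := by
      have h2 := key 1 (by simp)
      have h3 := key (-1) (by simp)
      rw [abs_lt]; constructor <;> linarith
    have h4 : inner ℝ w ((t / ‖v‖) • v) ≤ t * ‖V.starProjection w‖ := by
      rw [inner_smul_right, real_inner_comm, ← inner_starProjection_of_mem hv]
      have := real_inner_le_norm v (V.starProjection w)
      calc t / ‖v‖ * inner ℝ v (V.starProjection w)
          ≤ t / ‖v‖ * (‖v‖ * ‖V.starProjection w‖) := by gcongr
        _ = t * ‖V.starProjection w‖ := by field_simp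
    linarith
  obtain ⟨x, hx, hxv⟩ := hmem
  refine ⟨(‖v‖ / t) • x, ?_, ?_, fun q hq => by simp [hx.2 q hq]⟩
  · rw [synth_smul, hxv, smul_smul]
    field_simp
    simp
  · have hx1 : ∑ q, |x q| ≤ 1 := hx.1
    have : ∑ q, |((‖v‖ / t) • x) q| = ‖v‖ / t * ∑ q, |x q| := by
      have h0 : |‖v‖ / t| = ‖v‖ / t := abs_of_pos (div_pos hvn ht)
      simp [abs_mul, Finset.mul_sum, h0]
    rw [this]
    calc t * (‖v‖ / t * ∑ q, |x q|) = ‖v‖ * ∑ q, |x q| := by field_simp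
      _ ≤ ‖v‖ * 1 := by gcongr
      _ = ‖v‖ := mul_one _

/-- An atom outside `G` is replaced, after projection to `V`, by atoms of `G` at a strictly smaller
`ℓ¹` cost; so no minimizer uses it. -/
theorem IsBPSolution.eq_zero_of_notMem [Fintype J] (ht : 0 < t)
    (hin : ∀ w ∈ V, ∃ q ∈ G, t * ‖w‖ ≤ |inner ℝ (a q) w|) (hV : ∀ q ∈ G, a q ∈ V)
    (hout : ∀ q ∉ G, ‖V.starProjection (a q)‖ < t)
    {b : EuclideanSpace ℝ (Fin D)} (hb : b ∈ V) {x : J → ℝ} (hx : IsBPSolution a b x)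
    {q : J} (hq : q ∉ G) : x q = 0 := by
  classical
  by_contra hxq
  have hy : ∀ q, ∃ y : J → ℝ, synth a y = V.starProjection (a q) ∧ ∑ r, |y r| ≤ 1 ∧
      (q ∉ G → ∑ r, |y r| < 1) := by
    intro q
    by_cases hqG : q ∈ G
    · refine ⟨Pi.single q 1, ?_, by simp [Pi.single_apply, apply_ite abs], fun h => (h hqG).elim⟩
      rw [synth_single, one_smul, V.starProjection_eq_self_iff.2 (hV q hqG)]
    · obtain ⟨y, hy1, hy2, -⟩ := exists_synth_eq_of_forall_le_abs_inner ht hin hV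
        (V.starProjection_apply_mem (a q))
      have : ∑ r, |y r| < 1 := by
        have := hy2.trans_lt (hout q hqG)
        nlinarith
      exact ⟨y, hy1, this.le, fun _ => this⟩
  choose y hy1 hy2 hy3 using hy
  have hz : synth a (∑ r, x r • y r) = b := by
    rw [synth_sum]
    simp only [synth_smul, hy1]
    rw [← V.starProjection_eq_self_iff.2 hb]
    rw [← hx.1]
    simp [synth]
  have h1 := hx.2 _ hz
  have h2 : ∑ p, |(∑ r, x r • y r) p| ≤ ∑ r, |x r| * ∑ p, |y r p| := by
    simp only [Finset.mul_sum]
    rw [Finset.sum_comm]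
    refine Finset.sum_le_sum fun p _ => ?_
    rw [Finset.sum_apply]
    refine (Finset.abs_sum_le_sum_abs _ _).trans (le_of_eq ?_)
    simp [abs_mul]
  have h3 : ∑ r, |x r| * ∑ p, |y r p| < ∑ r, |x r| := by
    refine Finset.sum_lt_sum (fun r _ => mul_le_of_le_one_right (abs_nonneg _) (hy2 r))
      ⟨q, Finset.mem_univ _, ?_⟩
    exact mul_lt_of_lt_one_right (abs_pos.2 hxq) (hy3 q hq)
  linarith

theorem inner_ompResidual_eq_zero (b : EuclideanSpace ℝ (Fin D)) {W : Finset J} {q : J}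
    (hq : q ∈ W) : inner ℝ (a q) (ompResidual a b W) = 0 := by
  rw [real_inner_comm]
  exact Submodule.starProjection_inner_eq_zero _ _
    (Submodule.subset_span ⟨q, by simpa using hq, rfl⟩)

theorem ompResidual_mem (hV : ∀ q ∈ G, a q ∈ V) {b : EuclideanSpace ℝ (Fin D)} (hb : b ∈ V)
    {W : Finset J} (hW : (W : Set J) ⊆ G) : ompResidual a b W ∈ V := by
  refine V.sub_mem hb ?_
  refine (Submodule.span_le.2 ?_ : Submodule.span ℝ (a '' (W : Set J)) ≤ V)
    (Submodule.starProjection_apply_mem _ b)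
  rintro _ ⟨q, hq, rfl⟩
  exact hV q (hW hq)

/-- As long as the residual lies in `V`, an atom of `G` beats every atom outside `G`; so OMP
selects atoms of `G` only, and the residual stays in `V`. -/
theorem IsOMPRun.subset (hin : ∀ w ∈ V, ∃ q ∈ G, t * ‖w‖ ≤ |inner ℝ (a q) w|)
    (hV : ∀ q ∈ G, a q ∈ V) (hout : ∀ q ∉ G, ‖V.starProjection (a q)‖ < t)
    {b : EuclideanSpace ℝ (Fin D)} (hb : b ∈ V) {W : ℕ → Finset J} (hW : IsOMPRun a b W) (k : ℕ) :
    (W k : Set J) ⊆ G := by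
  classical
  induction k with
  | zero => simp [hW.1]
  | succ k ih =>
    by_cases hr : ompResidual a b (W k) = 0
    · rw [(hW.2 k).1 hr]; exact ih
    · obtain ⟨q, hmax, hq⟩ := (hW.2 k).2 hr
      have hrV := ompResidual_mem hV hb ih
      have hqG : q ∈ G := by
        by_contra hqG
        obtain ⟨q', -, hq'⟩ := hin _ hrV
        have h1 := hq'.trans (hmax q')
        rw [real_inner_comm, ← inner_starProjection_of_mem hrV] at h1
        have h2 := (h1.trans (abs_real_inner_le_norm _ _))
        have h3 := hout q hqG
        have h4 := norm_pos_iff.2 hr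
        nlinarith
      rw [hq, Finset.coe_insert]
      exact Set.insert_subset hqG ih

/-- While the residual is nonzero, OMP selects a new atom in each step. -/
theorem ompTerminates_of_inradius [Fintype J] (ht : 0 < t)
    (hin : ∀ w ∈ V, ∃ q ∈ G, t * ‖w‖ ≤ |inner ℝ (a q) w|)
    (hV : ∀ q ∈ G, a q ∈ V) (hout : ∀ q ∉ G, ‖V.starProjection (a q)‖ < t)
    {b : EuclideanSpace ℝ (Fin D)} (hb : b ∈ V) : OMPTerminates a b := by
  classical
  intro W hW
  by_contra! hne
  have hcard : ∀ k, k ≤ (W k).card := by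
    intro k
    induction k with
    | zero => simp
    | succ k ih =>
      obtain ⟨q, hmax, hq⟩ := (hW.2 k).2 (hne k)
      have hrV := ompResidual_mem hV hb (hW.subset hin hV hout hb k)
      have hqW : q ∉ W k := by
        intro hqW
        obtain ⟨q', -, hq'⟩ := hin _ hrV
        have h1 := hq'.trans (hmax q')
        rw [inner_ompResidual_eq_zero b hqW, abs_zero] at h1
        have h4 := norm_pos_iff.2 (hne k)
        nlinarith
      have hc := Finset.card_insert_of_notMem hqW
      have : (W (k + 1)).card = (W k).card + 1 := by
        rw [hq]; convert hc
      omega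
  have h1 := hcard (Fintype.card J + 1)
  have h2 := Finset.card_le_univ (W (Fintype.card J + 1))
  omega

end Deterministic

/-- If on each subspace the atoms of its group see every direction at level `t i`, and the other
atoms have a projection shorter than `t i`, then BP and OMP classify correctly. -/
theorem srcCorrect_of_inradius {n D : ℕ} {s : Fin n → ℕ}
    {S : Fin n → Submodule ℝ (EuclideanSpace ℝ (Fin D))}
    {a : (Σ i, Fin (s i)) → EuclideanSpace ℝ (Fin D)} {t : Fin n → ℝ} (ht : ∀ i, 0 < t i)
    (hin : ∀ i, ∀ w ∈ S i, ∃ j, t i * ‖w‖ ≤ |inner ℝ (a ⟨i, j⟩) w|)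
    (hmem : ∀ q, a q ∈ S q.1)
    (hout : ∀ i, ∀ q : Σ i, Fin (s i), q.1 ≠ i → ‖(S i).starProjection (a q)‖ < t i) :
    SRCCorrect S a := by
  intro i b hb
  have hin' : ∀ w ∈ S i, ∃ q ∈ {q : Σ i, Fin (s i) | q.1 = i},
      t i * ‖w‖ ≤ |inner ℝ (a q) w| := fun w hw =>
    let ⟨j, hj⟩ := hin i w hw
    ⟨⟨i, j⟩, rfl, hj⟩
  have hV : ∀ q ∈ {q : Σ i, Fin (s i) | q.1 = i}, a q ∈ S i := by
    rintro q rfl; exact hmem q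
  refine ⟨⟨exists_isBPSolution a ?_, fun x hx q hq => ?_⟩,
    ompTerminates_of_inradius (ht i) hin' hV (hout i) hb, ?_⟩
  · obtain ⟨x, hx, -⟩ := exists_synth_eq_of_forall_le_abs_inner (ht i) hin' hV hb
    exact ⟨x, hx⟩
  · by_contra h
    exact hq (hx.eq_zero_of_notMem (ht i) hin' hV (hout i) hb h)
  · rintro x ⟨W, k, hW, -, hx, -⟩ q hq
    by_contra h
    exact hq (hx q fun hqW => h (hW.subset hin' hV (hout i) hb k hqW))

/-! ### Volumes of cones -/

section Volume

open Module Metric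
open scoped Pointwise

theorem norm_add_sq_of_orthogonal {F : Type*} [NormedAddCommGroup F]
    [InnerProductSpace ℝ F] (s : Submodule ℝ F) (x : s) (y : sᗮ) :
    ‖(x : F) + (y : F)‖ ^ 2 = ‖x‖ ^ 2 + ‖y‖ ^ 2 := by
  rw [norm_add_sq_real, Submodule.inner_right_of_mem_orthogonal x.2 y.2]
  simp

variable {F : Type*} [NormedAddCommGroup F] [InnerProductSpace ℝ F] [FiniteDimensional ℝ F]
  [MeasurableSpace F] [BorelSpace F]

theorem unitBallVol_pos (p : ℕ) : 0 < unitBallVol p := by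
  unfold unitBallVol
  exact div_pos (by positivity) (Real.Gamma_pos_of_pos (by positivity))

theorem volume_ball_eq_unitBallVol [Nontrivial F] (r : ℝ) :
    volume (ball (0 : F) r) =
      ENNReal.ofReal r ^ finrank ℝ F * ENNReal.ofReal (unitBallVol (finrank ℝ F)) := by
  rw [InnerProductSpace.volume_ball, unitBallVol]
  have : √Real.pi ^ finrank ℝ F = Real.pi ^ ((finrank ℝ F : ℝ) / 2) := by
    rw [Real.sqrt_eq_rpow, ← Real.rpow_natCast, ← Real.rpow_mul Real.pi_pos.le]
    ring_nf
  rw [this]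

theorem volume_unitBall_eq [Nontrivial F] :
    volume (ball (0 : F) 1) = ENNReal.ofReal (unitBallVol (finrank ℝ F)) := by
  simp [volume_ball_eq_unitBallVol]

/-- Coordinates along a subspace and its orthogonal complement preserve the volume. -/
theorem measurePreserving_add_orthogonal (s : Submodule ℝ F) :
    MeasurePreserving (fun p : s × sᗮ => (p.1 : F) + (p.2 : F)) (volume.prod volume) volume := by
  have h := (s.measurePreserving_measurableEquivProd (0 : F)).symm
  rw [InnerProductSpace.euclideanHausdorffMeasure_eq_volume] at h
  convert! h using 1
  ext p
  simp

theorem measurePreserving_smul_add_orthogonal {u : F} (hu : ‖u‖ = 1) :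
    MeasurePreserving (fun p : ℝ × (ℝ ∙ u)ᗮ => p.1 • u + (p.2 : F)) (volume.prod volume)
      volume := by
  have h1 := (LinearIsometryEquiv.toSpanUnitSingleton (𝕜 := ℝ) u hu).measurePreserving
  have h2 := (measurePreserving_add_orthogonal (ℝ ∙ u)).comp
    (h1.prod (MeasurePreserving.id (volume : Measure (ℝ ∙ u)ᗮ)))
  convert! h2 using 1

/-- The double cone of half-angle `α` around `u`, cut by the unit ball, contains the two flat
cones over the `(d-1)`-dimensional balls of radius `sin α` at height `± cos α`. -/
theorem le_volume_doubleCone {u : F} (hu : ‖u‖ = 1) (hd : 2 ≤ finrank ℝ F) {α : ℝ}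
    (h0 : 0 < α) (h1 : α < Real.pi / 2) :
    ENNReal.ofReal (2 * unitBallVol (finrank ℝ F - 1) * Real.sin α ^ (finrank ℝ F - 1) *
      Real.cos α / finrank ℝ F) ≤
    volume {y : F | y ∈ ball (0 : F) 1 ∧ Real.cos α * ‖y‖ ≤ |inner ℝ u y|} := by
  have hc : 0 < Real.cos α := Real.cos_pos_of_mem_Ioo ⟨by linarith, h1⟩
  have hs : 0 < Real.sin α := Real.sin_pos_of_pos_of_lt_pi h0 (by linarith [Real.pi_pos])
  have hfr : finrank ℝ (ℝ ∙ u)ᗮ = finrank ℝ F - 1 := by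
    have := (ℝ ∙ u).finrank_add_finrank_orthogonal
    rw [finrank_span_singleton (by rintro rfl; simp at hu)] at this
    omega
  have : Nontrivial (ℝ ∙ u)ᗮ := nontrivial_of_finrank_pos (R := ℝ) (by omega)
  set m := finrank ℝ F - 1 with hm
  have hd1 : (finrank ℝ F : ℝ) = m + 1 := by
    have : finrank ℝ F = m + 1 := by omega
    rw [this]; push_cast; ring
  -- the upper flat cone
  set T : Set F := {y | (0 < inner ℝ u y ∧ inner ℝ u y < Real.cos α) ∧
    ‖y - (inner ℝ u y : ℝ) • u‖ < Real.tan α * inner ℝ u y} with hT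
  have hTm : MeasurableSet T := by
    have m1 : Measurable fun y : F => (inner ℝ u y : ℝ) := by fun_prop
    have m2 : Measurable fun y : F => ‖y - (inner ℝ u y : ℝ) • u‖ := by fun_prop
    exact ((measurableSet_lt measurable_const m1).inter (measurableSet_lt m1 measurable_const)).inter
      (measurableSet_lt m2 (m1.const_mul _))
  have hTv : ENNReal.ofReal (unitBallVol m * Real.sin α ^ m * Real.cos α / (m + 1)) = volume T := by
    rw [← (measurePreserving_smul_add_orthogonal hu).measure_preimage hTm.nullMeasurableSet,
      Measure.prod_apply ((measurePreserving_smul_add_orthogonal hu).measurable hTm)]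
    have hslice : ∀ h : ℝ, volume (Prod.mk h ⁻¹' ((fun p : ℝ × (ℝ ∙ u)ᗮ => p.1 • u + (p.2 : F)) ⁻¹' T))
        = (Set.Ioo 0 (Real.cos α)).indicator
          (fun h => ENNReal.ofReal ((Real.tan α * h) ^ m * unitBallVol m)) h := by
      intro h
      have hin : ∀ z : (ℝ ∙ u)ᗮ, inner ℝ u (h • u + (z : F)) = h := by
        intro z
        rw [inner_add_right, inner_smul_right, real_inner_self_eq_norm_sq, hu,
          Submodule.mem_orthogonal_singleton_iff_inner_right.1 z.2]
        simp
      by_cases hh : h ∈ Set.Ioo 0 (Real.cos α)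
      · have : Prod.mk h ⁻¹' ((fun p : ℝ × (ℝ ∙ u)ᗮ => p.1 • u + (p.2 : F)) ⁻¹' T) =
            ball (0 : (ℝ ∙ u)ᗮ) (Real.tan α * h) := by
          ext z
          simp only [hT, Set.mem_preimage, Set.mem_ofPred_eq, hin, mem_ball_zero_iff]
          simp [hh.1, hh.2]
        rw [this, volume_ball_eq_unitBallVol, Set.indicator_of_mem hh, hfr]
        have htan : 0 ≤ Real.tan α * h :=
          (mul_pos (Real.tan_pos_of_pos_of_lt_pi_div_two h0 h1) hh.1).le
        rw [ENNReal.ofReal_mul (pow_nonneg htan _), ENNReal.ofReal_pow htan]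
      · rw [Set.indicator_of_notMem hh]
        have : Prod.mk h ⁻¹' ((fun p : ℝ × (ℝ ∙ u)ᗮ => p.1 • u + (p.2 : F)) ⁻¹' T) = ∅ := by
          ext z
          simp only [hT, Set.mem_preimage, Set.mem_ofPred_eq, hin]
          simp only [Set.mem_empty_iff_false, iff_false]
          exact fun hz => hh hz.1
        rw [this, measure_empty]
    simp only [hslice]
    rw [lintegral_indicator measurableSet_Ioo, ← ofReal_integral_eq_lintegral_ofReal]
    · congr 1
      rw [← integral_Ioc_eq_integral_Ioo, ← intervalIntegral.integral_of_le hc.le]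
      simp only [mul_pow]
      rw [intervalIntegral.integral_mul_const, intervalIntegral.integral_const_mul, integral_pow,
        Real.tan_eq_sin_div_cos, div_pow]
      simp only [ne_eq, Nat.add_eq_zero_iff, one_ne_zero, and_false, not_false_eq_true, zero_pow,
        sub_zero]
      field_simp
      ring
    · refine IntegrableOn.mono_set ?_ Set.Ioo_subset_Icc_self
      exact ContinuousOn.integrableOn_Icc (by fun_prop)
    · refine (ae_restrict_iff' measurableSet_Ioo).2 (Filter.Eventually.of_forall fun h hh => ?_)
      have := Real.tan_pos_of_pos_of_lt_pi_div_two h0 h1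
      have := unitBallVol_pos m
      have := hh.1
      simp only [Pi.zero_apply]
      positivity
  have hsub : ∀ y ∈ T, y ∈ ball (0 : F) 1 ∧ Real.cos α * ‖y‖ ≤ inner ℝ u y := by
    rintro y ⟨⟨hy0, hy1⟩, hy2⟩
    set h : ℝ := inner ℝ u y with hh
    have hpyth : ‖y‖ ^ 2 = h ^ 2 + ‖y - h • u‖ ^ 2 := by
      rw [norm_sub_sq_real, inner_smul_right, real_inner_comm, ← hh, norm_smul, hu]
      simp only [Real.norm_eq_abs, mul_one, sq_abs]
      ring
    have hz : (Real.cos α * ‖y - h • u‖) ^ 2 ≤ (Real.sin α * h) ^ 2 := by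
      have h3 : Real.cos α * ‖y - h • u‖ ≤ Real.sin α * h := by
        have := mul_le_mul_of_nonneg_left hy2.le hc.le
        rw [← mul_assoc, mul_comm (Real.cos α) (Real.tan α), Real.tan_mul_cos hc.ne'] at this
        exact this
      gcongr
    have h4 : (Real.cos α * ‖y‖) ^ 2 ≤ h ^ 2 := by
      have := Real.sin_sq_add_cos_sq α
      calc (Real.cos α * ‖y‖) ^ 2 = (Real.cos α * h) ^ 2 + (Real.cos α * ‖y - h • u‖) ^ 2 := by
            rw [mul_pow, hpyth]; ring
        _ ≤ (Real.cos α * h) ^ 2 + (Real.sin α * h) ^ 2 := by gcongr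
        _ = h ^ 2 * (Real.sin α ^ 2 + Real.cos α ^ 2) := by ring
        _ = h ^ 2 := by rw [this, mul_one]
    have h5 : Real.cos α * ‖y‖ ≤ h := (sq_le_sq₀ (by positivity) hy0.le).1 h4
    refine ⟨?_, h5⟩
    rw [mem_ball_zero_iff]
    have : Real.cos α * ‖y‖ < Real.cos α * 1 := by linarith
    exact lt_of_mul_lt_mul_left this hc.le
  have hdisj : Disjoint T (-T) := by
    rw [Set.disjoint_left]
    intro y hy hy'
    have h1 := hy.1.1
    have h2 := hy'.1.1
    rw [inner_neg_right] at h2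
    linarith
  calc ENNReal.ofReal (2 * unitBallVol m * Real.sin α ^ m * Real.cos α / finrank ℝ F)
      = volume T + volume (-T) := by
        rw [Measure.measure_neg, ← hTv, ← ENNReal.ofReal_add, hd1]
        · congr 1; ring
        all_goals have := unitBallVol_pos m; positivity
    _ = volume (T ∪ -T) := (measure_union hdisj hTm.neg).symm
    _ ≤ _ := by
        refine measure_mono (Set.union_subset (fun y hy => ?_) (fun y hy => ?_))
        · exact ⟨(hsub y hy).1, (hsub y hy).2.trans (le_abs_self _)⟩
        · have := hsub _ hy
          rw [mem_ball_zero_iff, norm_neg, inner_neg_right] at this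
          exact ⟨mem_ball_zero_iff.2 this.1, this.2.trans (neg_le_abs _)⟩

/-- Scaling for a cone `K`; for `r = 0` both sides vanish, as the dimension is positive. -/
theorem volume_cone_inter_ball (hd : 0 < finrank ℝ F) {K : Set F}
    (hK : ∀ c : ℝ, 0 < c → ∀ y, c • y ∈ K ↔ y ∈ K) {r : ℝ} (hr : 0 ≤ r) :
    volume (K ∩ ball 0 r) = ENNReal.ofReal r ^ finrank ℝ F * volume (K ∩ ball 0 1) := by
  rcases hr.eq_or_lt with rfl | hr
  · simp [hd.ne']
  · have : K ∩ ball 0 r = r • (K ∩ ball 0 1) := by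
      ext y
      rw [Set.mem_smul_set_iff_inv_smul_mem₀ hr.ne']
      simp only [Set.mem_inter_iff, mem_ball_zero_iff, hK _ (inv_pos.2 hr), norm_smul, norm_inv,
        Real.norm_eq_abs, abs_of_pos hr]
      rw [inv_mul_lt_one₀ hr]
    rw [this, Measure.addHaar_smul, abs_of_nonneg (by positivity), ENNReal.ofReal_pow hr.le]

/-- The orthogonal projection to `s` of a uniform point of the unit ball has a uniformly
distributed direction: cones of `s` have the same relative volume in both unit balls. -/
theorem volume_ball_mul_volume_cone (s : Submodule ℝ F) (hs : 0 < finrank ℝ s) {K : Set s}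
    (hKm : MeasurableSet K) (hK : ∀ c : ℝ, 0 < c → ∀ y, c • y ∈ K ↔ y ∈ K) :
    volume (ball (0 : F) 1) * volume (K ∩ ball 0 1) =
      volume {g : F | g ∈ ball (0 : F) 1 ∧ s.orthogonalProjectionOnto g ∈ K} *
        volume (ball (0 : s) 1) := by
  have key : ∀ K : Set s, MeasurableSet K → (∀ c : ℝ, 0 < c → ∀ y, c • y ∈ K ↔ y ∈ K) →
      volume {g : F | g ∈ ball (0 : F) 1 ∧ s.orthogonalProjectionOnto g ∈ K} =
        (∫⁻ y : sᗮ, ENNReal.ofReal √(1 - ‖y‖ ^ 2) ^ finrank ℝ s) * volume (K ∩ ball 0 1) := by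
    intro K hKm hK
    have hm : MeasurableSet {g : F | g ∈ ball (0 : F) 1 ∧ s.orthogonalProjectionOnto g ∈ K} :=
      measurableSet_ball.inter (s.orthogonalProjectionOnto.continuous.measurable hKm)
    rw [← (measurePreserving_add_orthogonal s).measure_preimage hm.nullMeasurableSet,
      Measure.prod_apply_symm ((measurePreserving_add_orthogonal s).measurable hm),
      ← lintegral_mul_const]
    · congr 1
      ext y
      rw [← volume_cone_inter_ball hs hK (Real.sqrt_nonneg _)]
      congr 1
      ext x
      simp only [Set.mem_preimage, Set.mem_ofPred_eq, mem_ball_zero_iff, Set.mem_inter_iff]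
      have h1 : s.orthogonalProjectionOnto ((x : F) + (y : F)) = x := by
        rw [map_add, Submodule.orthogonalProjectionOnto_mem_subspace_eq_self,
          Submodule.orthogonalProjectionOnto_apply_of_mem_orthogonal y.2, add_zero]
      have h2 : ‖(x : F) + (y : F)‖ < 1 ↔ ‖x‖ < √(1 - ‖y‖ ^ 2) := by
        rw [Real.lt_sqrt (norm_nonneg _), ← sq_lt_one_iff₀ (norm_nonneg _),
          norm_add_sq_of_orthogonal]
        constructor <;> intro h <;> linarith
      rw [h1, h2, and_comm]
    · fun_prop
  have h1 := key K hKm hK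
  have h2 := key Set.univ MeasurableSet.univ (by simp)
  simp only [Set.mem_univ, and_true, Set.univ_inter] at h2
  rw [show volume (ball (0 : F) 1) = _ from h2, h1]
  ring

/-- Comparison of products of balls: the points of the unit ball at angle at most `arccos t` from
the subspace `s` lie in the product of the unit ball of `s` and the `ε`-ball of `sᗮ`, while the unit
ball contains the product of the balls of radii `√(d/D)` and `√((D-d)/D)`. -/
theorem volume_ball_inter_le_norm_starProjection (s : Submodule ℝ F) (hs : 0 < finrank ℝ s)
    (hs' : 0 < finrank ℝ sᗮ) {t ε : ℝ} (ht : 0 ≤ t) (hε : 0 ≤ ε) (htε : t ^ 2 + ε ^ 2 = 1) :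
    ENNReal.ofReal √(finrank ℝ s / finrank ℝ F) ^ finrank ℝ s *
      ENNReal.ofReal √(finrank ℝ sᗮ / finrank ℝ F) ^ finrank ℝ sᗮ *
      volume {x : F | x ∈ ball (0 : F) 1 ∧ t * ‖x‖ ≤ ‖s.starProjection x‖} ≤
    ENNReal.ofReal ε ^ finrank ℝ sᗮ * volume (ball (0 : F) 1) := by
  have hsum := s.finrank_add_finrank_orthogonal
  have : Nontrivial s := nontrivial_of_finrank_pos (R := ℝ) hs
  have : Nontrivial sᗮ := nontrivial_of_finrank_pos (R := ℝ) hs'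
  set d := finrank ℝ s
  set e := finrank ℝ sᗮ
  set D := finrank ℝ F
  have hD : (D : ℝ) = d + e := by rw [← hsum]; push_cast; ring
  have hdp : (0 : ℝ) < d := by exact_mod_cast hs
  have hep : (0 : ℝ) < e := by exact_mod_cast hs'
  have hmp := measurePreserving_add_orthogonal s
  have h1 : volume {x : F | x ∈ ball (0 : F) 1 ∧ t * ‖x‖ ≤ ‖s.starProjection x‖} ≤
      volume (closedBall (0 : s) 1) * volume (closedBall (0 : sᗮ) ε) := by
    have hm : MeasurableSet {x : F | x ∈ ball (0 : F) 1 ∧ t * ‖x‖ ≤ ‖s.starProjection x‖} :=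
      measurableSet_ball.inter (measurableSet_le (measurable_norm.const_mul t)
        (s.starProjection.continuous.norm.measurable))
    rw [← hmp.measure_preimage hm.nullMeasurableSet, ← Measure.prod_prod]
    refine measure_mono ?_
    rintro ⟨x, y⟩ ⟨hb, hxy⟩
    rw [mem_ball_zero_iff] at hb
    have hproj : s.starProjection ((x : F) + (y : F)) = x := by
      rw [map_add, Submodule.starProjection_eq_self_iff.2 x.2,
        (s.starProjection_apply_eq_zero_iff).2 y.2, add_zero]
    have hsq := norm_add_sq_of_orthogonal s x y
    simp only at hb hxy
    rw [hproj] at hxy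
    change t * _ ≤ ‖x‖ at hxy
    have hb2 : ‖(x : F) + (y : F)‖ ^ 2 ≤ 1 := by
      have := norm_nonneg ((x : F) + (y : F)); nlinarith
    have hxy2 : t ^ 2 * ‖(x : F) + (y : F)‖ ^ 2 ≤ ‖x‖ ^ 2 := by
      rw [← mul_pow]; gcongr
    simp only [Set.mem_prod, mem_closedBall_zero_iff]
    constructor
    · have : ‖x‖ ^ 2 ≤ 1 ^ 2 := by nlinarith [sq_nonneg ‖y‖]
      exact (sq_le_sq₀ (norm_nonneg _) one_pos.le).1 this
    · refine (sq_le_sq₀ (norm_nonneg _) hε).1 ?_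
      nlinarith [sq_nonneg ε]
  have h2 : volume (ball (0 : s) √(d / D)) * volume (ball (0 : sᗮ) √(e / D)) ≤
      volume (ball (0 : F) 1) := by
    rw [← hmp.measure_preimage measurableSet_ball.nullMeasurableSet, ← Measure.prod_prod]
    refine measure_mono ?_
    rintro ⟨x, y⟩ ⟨hx, hy⟩
    simp only [mem_ball_zero_iff] at hx hy
    rw [Real.lt_sqrt (norm_nonneg _)] at hx hy
    simp only [Set.mem_preimage, mem_ball_zero_iff]
    rw [← sq_lt_one_iff₀ (norm_nonneg _), norm_add_sq_of_orthogonal]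
    have : (d : ℝ) / D + e / D = 1 := by rw [hD]; field_simp
    linarith
  rw [volume_ball_eq_unitBallVol, volume_ball_eq_unitBallVol] at h2
  rw [Measure.addHaar_closedBall_eq_addHaar_ball, Measure.addHaar_closedBall_eq_addHaar_ball,
    volume_ball_eq_unitBallVol, volume_ball_eq_unitBallVol] at h1
  calc _ ≤ _ := mul_le_mul_right h1 _
    _ = ENNReal.ofReal ε ^ e * (ENNReal.ofReal √(d / D) ^ d * ENNReal.ofReal (unitBallVol d) *
        (ENNReal.ofReal √(e / D) ^ e * ENNReal.ofReal (unitBallVol e))) := by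
      rw [ENNReal.ofReal_one, one_pow]; ring
    _ ≤ _ := mul_le_mul_right h2 _

end Volume

/-! ### Caps of the unit sphere of a subspace -/

section Caps

open Module Metric
open scoped Pointwise

/-- A lower bound for the normalized area of the double cap `{x | cos α ≤ |⟪x, u⟫|}` of the unit
sphere of a `d`-dimensional space: the relative volume of the two flat cones inscribed in it. -/
noncomputable def capBound (d : ℕ) (α : ℝ) : ℝ :=
  2 * unitBallVol (d - 1) * Real.sin α ^ (d - 1) * Real.cos α / d / unitBallVol d

theorem capBound_mul_unitBallVol (d : ℕ) (α : ℝ) : capBound d α * unitBallVol d =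
    2 * unitBallVol (d - 1) * Real.sin α ^ (d - 1) * Real.cos α / d := by
  rw [capBound, div_mul_cancel₀ _ (unitBallVol_pos d).ne']

variable {D : ℕ} (S : Submodule ℝ (EuclideanSpace ℝ (Fin D)))

theorem uniformOnSphere_apply {A : Set (EuclideanSpace ℝ (Fin D))} (hA : MeasurableSet A) :
    uniformOnSphere S A = ((volume : Measure S).toSphere Set.univ)⁻¹ *
      (volume : Measure S).toSphere {x | ((x : S) : EuclideanSpace ℝ (Fin D)) ∈ A} := by
  rw [uniformOnSphere, Measure.map_apply (by fun_prop) hA]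
  rfl

variable {S}

theorem toSphere_univ_ne_zero (hS : 0 < finrank ℝ S) :
    (volume : Measure S).toSphere Set.univ ≠ 0 := by
  have : Nontrivial S := nontrivial_of_finrank_pos (R := ℝ) hS
  exact (Measure.measure_univ_ne_zero).2 (Measure.toSphere_ne_zero _)

theorem isProbabilityMeasure_uniformOnSphere (hS : 0 < finrank ℝ S) :
    IsProbabilityMeasure (uniformOnSphere S) := by
  constructor
  rw [uniformOnSphere_apply S MeasurableSet.univ]
  simp only [Set.mem_univ, Set.ofPred_true]
  exact ENNReal.inv_mul_cancel (toSphere_univ_ne_zero hS) (measure_ne_top _ _)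

/-- A uniform point of the unit sphere of `S` avoids the double cap of angle `α` around the
projection of `g` with probability at most `1 - capBound d α`. -/
theorem uniformOnSphere_le_one_sub_capBound {d : ℕ} (hd : 2 ≤ d) (hS : finrank ℝ S = d)
    {α : ℝ} (h0 : 0 < α) (h1 : α < Real.pi / 2) {g : EuclideanSpace ℝ (Fin D)}
    (hg : S.starProjection g ≠ 0) :
    uniformOnSphere S {x | |inner ℝ x g| < Real.cos α * ‖S.starProjection g‖} ≤
      1 - ENNReal.ofReal (capBound d α) := by
  have hS0 : 0 < finrank ℝ S := by omega
  have hnt : Nontrivial S := nontrivial_of_finrank_pos (R := ℝ) hS0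
  have hprob := isProbabilityMeasure_uniformOnSphere hS0
  have hAm : MeasurableSet {x : EuclideanSpace ℝ (Fin D) |
      |inner ℝ x g| < Real.cos α * ‖S.starProjection g‖} :=
    (isOpen_lt (by fun_prop) continuous_const).measurableSet
  suffices h : ENNReal.ofReal (capBound d α) ≤ uniformOnSphere S
      {x | |inner ℝ x g| < Real.cos α * ‖S.starProjection g‖}ᶜ by
    rw [prob_compl_eq_one_sub hAm] at h
    exact ENNReal.le_sub_of_add_le_left ENNReal.ofReal_ne_top (by
      have := add_le_add_left h (uniformOnSphere S
        {x | |inner ℝ x g| < Real.cos α * ‖S.starProjection g‖})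
      rwa [tsub_add_cancel_of_le prob_le_one] at this)
  set y : S := ⟨S.starProjection g, S.starProjection_apply_mem g⟩ with hy
  have hyn : 0 < ‖S.starProjection g‖ := norm_pos_iff.2 hg
  set u : S := ‖S.starProjection g‖⁻¹ • y with hu
  have hu1 : ‖u‖ = 1 := by
    rw [hu, norm_smul, norm_inv, norm_norm]
    exact inv_mul_cancel₀ hyn.ne'
  have hcone := le_volume_doubleCone hu1 (by omega) h0 h1
  rw [hS, ← capBound_mul_unitBallVol, ENNReal.ofReal_mul' (unitBallVol_pos d).le] at hcone
  rw [uniformOnSphere_apply S hAm.compl, Measure.toSphere_apply_univ, hS]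
  have hpre : MeasurableSet {x : sphere (0 : S) 1 | ((x : S) : EuclideanSpace ℝ (Fin D)) ∈
      {x | |inner ℝ x g| < Real.cos α * ‖S.starProjection g‖}ᶜ} :=
    (show Measurable fun x : sphere (0 : S) 1 => ((x : S) : EuclideanSpace ℝ (Fin D)) by
      fun_prop) hAm.compl
  rw [Measure.toSphere_apply' _ hpre, hS, volume_unitBall_eq, hS]
  have hsub : {y : S | y ∈ ball (0 : S) 1 ∧ Real.cos α * ‖y‖ ≤ |inner ℝ u y|} \ {0} ⊆
      Set.Ioo (0 : ℝ) 1 • (Subtype.val '' {x : sphere (0 : S) 1 |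
        ((x : S) : EuclideanSpace ℝ (Fin D)) ∈
        {x | |inner ℝ x g| < Real.cos α * ‖S.starProjection g‖}ᶜ}) := by
    rintro z ⟨⟨hz1, hz2⟩, hz0⟩
    rw [mem_ball_zero_iff] at hz1
    have hzn : 0 < ‖z‖ := norm_pos_iff.2 hz0
    have hzs : ‖z‖⁻¹ • z ∈ sphere (0 : S) 1 := by
      rw [mem_sphere_zero_iff_norm, norm_smul, norm_inv, norm_norm, inv_mul_cancel₀ hzn.ne']
    refine ⟨‖z‖, ⟨hzn, hz1⟩, _, ⟨⟨‖z‖⁻¹ • z, hzs⟩, ?_, rfl⟩, ?_⟩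
    · simp only [Set.mem_ofPred_eq, Set.mem_compl_iff, not_lt]
      rw [← inner_starProjection_of_mem (‖z‖⁻¹ • z : S).2]
      have h3 : inner ℝ u z = ‖S.starProjection g‖⁻¹ *
          inner ℝ (z : EuclideanSpace ℝ (Fin D)) (S.starProjection g) := by
        rw [hu, Submodule.coe_inner, Submodule.coe_smul, real_inner_smul_left, real_inner_comm]
      rw [h3, abs_mul, abs_of_pos (inv_pos.2 hyn), inv_mul_eq_div, le_div_iff₀ hyn] at hz2
      rw [Submodule.coe_smul, inner_smul_left, abs_mul]
      simp only [conj_trivial, abs_inv, abs_norm]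
      rw [inv_mul_eq_div, le_div_iff₀ hzn]
      linarith
    · simp only [smul_smul, mul_inv_cancel₀ hzn.ne', one_smul]
  have hvol := (measure_sdiff_null (s := {y : S | y ∈ ball (0 : S) 1 ∧
    Real.cos α * ‖y‖ ≤ |inner ℝ u y|}) (measure_singleton (μ := volume) (0 : S))).ge.trans
    (measure_mono hsub)
  have hv0 : ENNReal.ofReal (unitBallVol d) ≠ 0 := by simp [unitBallVol_pos]
  have hd0 : (d : ENNReal) ≠ 0 := by simp; omega
  rw [mul_comm (_ * _)⁻¹, ← div_eq_mul_inv, ENNReal.mul_div_mul_left _ _ hd0 (by simp),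
    ENNReal.le_div_iff_mul_le (Or.inl hv0) (Or.inl ENNReal.ofReal_ne_top)]
  exact hcone.trans hvol

/-- A uniform point `g` of the unit ball of `ℝ^D` has a projection to `S` in the double cone of
half-angle `α` around `w ∈ S` with probability at least `capBound d α`. -/
theorem capBound_mul_volume_ball_le {d : ℕ} (hd : 2 ≤ d) (hS : finrank ℝ S = d)
    {α : ℝ} (h0 : 0 < α) (h1 : α < Real.pi / 2) {w : EuclideanSpace ℝ (Fin D)} (hw : w ∈ S)
    (hw1 : ‖w‖ = 1) :
    ENNReal.ofReal (capBound d α) * volume (ball (0 : EuclideanSpace ℝ (Fin D)) 1) ≤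
      volume {g : EuclideanSpace ℝ (Fin D) | g ∈ ball 0 1 ∧
        Real.cos α * ‖S.starProjection g‖ ≤ |inner ℝ w g|} := by
  have hS0 : 0 < finrank ℝ S := by omega
  have hnt : Nontrivial S := nontrivial_of_finrank_pos (R := ℝ) hS0
  set u : S := ⟨w, hw⟩ with hu
  have hu1 : ‖u‖ = 1 := hw1
  have hcone := le_volume_doubleCone hu1 (by omega) h0 h1
  rw [hS, ← capBound_mul_unitBallVol, ENNReal.ofReal_mul' (unitBallVol_pos d).le] at hcone
  have hK := volume_ball_mul_volume_cone S hS0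
    (K := {y : S | Real.cos α * ‖y‖ ≤ |inner ℝ u y|})
    (isClosed_le (by fun_prop) (by fun_prop)).measurableSet (by
      intro c hc y
      have h3 : inner ℝ u (c • y) = c * inner ℝ u y := by
        rw [Submodule.coe_inner, Submodule.coe_smul, inner_smul_right, Submodule.coe_inner]
      simp only [Set.mem_ofPred_eq, h3, norm_smul, abs_mul, Real.norm_eq_abs, abs_of_pos hc]
      rw [mul_left_comm, mul_le_mul_iff_right₀ hc])
  have hcongr : {g : EuclideanSpace ℝ (Fin D) | g ∈ ball (0 : EuclideanSpace ℝ (Fin D)) 1 ∧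
      S.orthogonalProjectionOnto g ∈ {y : S | Real.cos α * ‖y‖ ≤ |inner ℝ u y|}} =
      {g | g ∈ ball 0 1 ∧ Real.cos α * ‖S.starProjection g‖ ≤ |inner ℝ w g|} := by
    ext g
    simp only [Set.mem_ofPred_eq]
    rw [← inner_starProjection_of_mem hw]
    rfl
  rw [hcongr, volume_unitBall_eq (F := S), hS] at hK
  have hv0 : ENNReal.ofReal (unitBallVol d) ≠ 0 := by simp [unitBallVol_pos]
  rw [← ENNReal.mul_le_mul_iff_left hv0 ENNReal.ofReal_ne_top, ← hK]
  calc _ = volume (ball (0 : EuclideanSpace ℝ (Fin D)) 1) *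
        (ENNReal.ofReal (capBound d α) * ENNReal.ofReal (unitBallVol d)) := by ring
    _ ≤ _ := by
      gcongr
      refine hcone.trans (le_of_eq ?_)
      congr 1
      ext y
      simp only [Set.mem_ofPred_eq, Set.mem_inter_iff, and_comm]

end Caps

/-! ### Random subspaces -/

section RandomSubspaces

open Module Metric

variable {D : ℕ}

theorem measurable_starProjection :
    Measurable fun S : Submodule ℝ (EuclideanSpace ℝ (Fin D)) => S.starProjection :=
  comap_measurable _

theorem measurable_starProjection_apply : Measurable
    fun p : Submodule ℝ (EuclideanSpace ℝ (Fin D)) × EuclideanSpace ℝ (Fin D) =>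
      p.1.starProjection p.2 := by
  have h : ∀ p : Submodule ℝ (EuclideanSpace ℝ (Fin D)) × EuclideanSpace ℝ (Fin D),
      p.1.starProjection p.2 =
        ∑ i, p.2 i • p.1.starProjection (EuclideanSpace.basisFun (Fin D) ℝ i) := by
    intro p
    conv_lhs => rw [← (EuclideanSpace.basisFun (Fin D) ℝ).sum_repr p.2]
    simp
  simp only [h]
  refine Finset.measurable_sum _ fun i _ => ?_
  have h1 : Measurable fun p : Submodule ℝ (EuclideanSpace ℝ (Fin D)) ×
      EuclideanSpace ℝ (Fin D) => p.2 i :=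
    (by fun_prop : Measurable fun x : EuclideanSpace ℝ (Fin D) => x i).comp measurable_snd
  exact h1.smul ((ContinuousLinearMap.measurable_apply _).comp
    (measurable_starProjection.comp measurable_fst))

/-- The rotation invariance of the law of a random subspace makes all unit vectors alike. -/
theorem IsUniformSubspaceLaw.measure_le_norm_eq {d : ℕ}
    {μ : Measure (Submodule ℝ (EuclideanSpace ℝ (Fin D)))} (hμ : IsUniformSubspaceLaw d μ)
    {x y : EuclideanSpace ℝ (Fin D)} (hxy : ‖x‖ = ‖y‖) (t : ℝ) :
    μ {S | t ≤ ‖S.starProjection x‖} = μ {S | t ≤ ‖S.starProjection y‖} := by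
  have := hμ.isProbabilityMeasure
  set U := (ℝ ∙ (y - x))ᗮ.reflection with hU
  have hUx : U.symm x = y := by
    rw [LinearIsometryEquiv.symm_apply_eq]
    exact (Submodule.reflection_sub hxy.symm).symm
  have hae : AEMeasurable (fun S : Submodule ℝ (EuclideanSpace ℝ (Fin D)) =>
      S.map U.toLinearEquiv.toLinearMap) μ := by
    by_contra hn
    have h := hμ.invariant U
    rw [Measure.map_of_not_aemeasurable hn] at h
    exact IsProbabilityMeasure.ne_zero μ h.symm
  have hm : MeasurableSet {S : Submodule ℝ (EuclideanSpace ℝ (Fin D)) |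
      t ≤ ‖S.starProjection x‖} :=
    measurableSet_le measurable_const
      (measurable_starProjection_apply.comp (measurable_id.prodMk measurable_const)).norm
  conv_lhs => rw [← hμ.invariant U]
  rw [Measure.map_apply_of_aemeasurable hae hm]
  congr 1
  ext S
  simp only [Set.mem_preimage, Set.mem_ofPred_eq]
  have h := Submodule.starProjection_map_apply U S x
  change t ≤ ‖(S.map (U.toLinearEquiv : _ →ₗ[ℝ] _)).starProjection x‖ ↔ _
  rw [h, hUx, LinearIsometryEquiv.norm_map]

/-- A uniform random `d`-dimensional subspace makes an angle of cosine at least `t` with a given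
unit vector with probability at most `(D/d)^{d/2} (D/(D-d))^{(D-d)/2} ε^{D-d}`,
where `ε = √(1 - t²)`. -/
theorem IsUniformSubspaceLaw.measure_le_norm_starProjection_le {d : ℕ}
    {μ : Measure (Submodule ℝ (EuclideanSpace ℝ (Fin D)))} (hμ : IsUniformSubspaceLaw d μ)
    (hd : 0 < d) (hdD : d < D) {t ε : ℝ} (ht : 0 ≤ t) (hε : 0 ≤ ε) (htε : t ^ 2 + ε ^ 2 = 1)
    {x : EuclideanSpace ℝ (Fin D)} (hx : ‖x‖ = 1) :
    ENNReal.ofReal √((d : ℝ) / D) ^ d * ENNReal.ofReal √(((D - d : ℕ) : ℝ) / D) ^ (D - d) *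
      μ {S | t ≤ ‖S.starProjection x‖} ≤ ENNReal.ofReal ε ^ (D - d) := by
  have := hμ.isProbabilityMeasure
  set κ := μ {S | t ≤ ‖S.starProjection x‖} with hκ
  set A := ENNReal.ofReal √((d : ℝ) / D) ^ d * ENNReal.ofReal √(((D - d : ℕ) : ℝ) / D) ^ (D - d)
  set B := ball (0 : EuclideanSpace ℝ (Fin D)) 1 with hB
  set H : Set (Submodule ℝ (EuclideanSpace ℝ (Fin D)) × EuclideanSpace ℝ (Fin D)) :=
    {p | t * ‖p.2‖ ≤ ‖p.1.starProjection p.2‖} with hH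
  have hHm : MeasurableSet H :=
    measurableSet_le (measurable_snd.norm.const_mul t) measurable_starProjection_apply.norm
  have hne : Nontrivial (EuclideanSpace ℝ (Fin D)) :=
    nontrivial_of_finrank_pos (R := ℝ) (by rw [finrank_euclideanSpace_fin]; omega)
  have h1 : (μ.prod (volume.restrict B)) H = κ * volume B := by
    rw [Measure.prod_apply_symm hHm]
    have : ∀ᵐ y ∂(volume.restrict B), μ ((fun S => (S, y)) ⁻¹' H) = κ := by
      have h0 : ∀ᵐ y : EuclideanSpace ℝ (Fin D) ∂volume, y ≠ 0 :=
        Measure.ae_ne volume 0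
      filter_upwards [ae_restrict_of_ae h0] with y hy
      have hy' : 0 < ‖y‖ := norm_pos_iff.2 hy
      rw [hκ, hμ.measure_le_norm_eq (x := x) (y := ‖y‖⁻¹ • y)
        (by rw [hx, norm_smul, norm_inv, norm_norm, inv_mul_cancel₀ hy'.ne'])]
      congr 1
      ext S
      simp only [hH, Set.mem_preimage, Set.mem_ofPred_eq, map_smul, norm_smul, norm_inv, norm_norm]
      rw [inv_mul_eq_div, le_div_iff₀ hy']
    rw [lintegral_congr_ae this]
    simp
  have h2 : A * (μ.prod (volume.restrict B)) H ≤ ENNReal.ofReal ε ^ (D - d) * volume B := by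
    rw [Measure.prod_apply hHm, ← lintegral_const_mul _ (measurable_measure_prodMk_left hHm)]
    calc _ ≤ ∫⁻ _, ENNReal.ofReal ε ^ (D - d) * volume B ∂μ := by
          refine lintegral_mono_ae ?_
          filter_upwards [hμ.finrank_eq] with S hS
          have hS' : finrank ℝ Sᗮ = D - d := by
            have := S.finrank_add_finrank_orthogonal
            rw [finrank_euclideanSpace_fin] at this
            omega
          have hv := volume_ball_inter_le_norm_starProjection S (by omega) (by omega) ht hε htε
          rw [hS, hS', finrank_euclideanSpace_fin] at hv
          refine le_trans (le_of_eq ?_) hv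
          rw [Measure.restrict_apply (measurable_prodMk_left hHm)]
          congr 2
          ext y
          simp [hH, hB, and_comm]
      _ = _ := by simp
  rw [h1, ← mul_assoc] at h2
  exact (ENNReal.mul_le_mul_iff_left (measure_ball_pos volume _ one_pos).ne'
    measure_ball_lt_top.ne).1 h2

end RandomSubspaces

/-! ### Random samples in a random subspace -/

section Samples

open Module Metric

variable {D : ℕ}

theorem uniformOnSphere_eq_zero_of_forall {S : Submodule ℝ (EuclideanSpace ℝ (Fin D))}
    {A : Set (EuclideanSpace ℝ (Fin D))} (hA : MeasurableSet A)
    (h : ∀ x ∈ S, ‖x‖ = 1 → x ∉ A) : uniformOnSphere S A = 0 := by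
  rw [uniformOnSphere_apply S hA]
  have : {x : sphere (0 : S) 1 | ((x : S) : EuclideanSpace ℝ (Fin D)) ∈ A} = ∅ := by
    ext x
    simp only [Set.mem_ofPred_eq, Set.mem_empty_iff_false, iff_false]
    exact h _ (x : S).2 (mem_sphere_zero_iff_norm.1 x.2)
  rw [this, measure_empty, mul_zero]

variable {Ω : Type*} [MeasurableSpace Ω] {P : Measure Ω}
  {S : Ω → Submodule ℝ (EuclideanSpace ℝ (Fin D))} {s : ℕ}
  {a : Fin s → Ω → EuclideanSpace ℝ (Fin D)}

/-- Given the subspace `S ω`, the points `a j ω` are independent and uniform on its unit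
sphere. -/
def IsSphereSample (P : Measure Ω) (S : Ω → Submodule ℝ (EuclideanSpace ℝ (Fin D)))
    (a : Fin s → Ω → EuclideanSpace ℝ (Fin D)) : Prop :=
  ∀ B : Set (Submodule ℝ (EuclideanSpace ℝ (Fin D))), MeasurableSet B →
    ∀ A : Fin s → Set (EuclideanSpace ℝ (Fin D)), (∀ j, MeasurableSet (A j)) →
      P {ω | S ω ∈ B ∧ ∀ j, a j ω ∈ A j} =
        ∫⁻ ω in S ⁻¹' B, ∏ j, uniformOnSphere (S ω) (A j) ∂P

/-- A set that is null for the uniform law on the sphere of every subspace of `B` is avoided by the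
sample whenever the random subspace lies in `B`. -/
theorem IsSphereSample.measure_eq_zero (hS : Measurable S) (h : IsSphereSample P S a) (j : Fin s)
    {B : Set (Submodule ℝ (EuclideanSpace ℝ (Fin D)))} (hB : MeasurableSet B)
    {A : Set (EuclideanSpace ℝ (Fin D))} (hA : MeasurableSet A)
    (h0 : ∀ S ∈ B, uniformOnSphere S A = 0) : P {ω | S ω ∈ B ∧ a j ω ∈ A} = 0 := by
  classical
  have h1 := h B hB (Function.update (fun _ => Set.univ) j A) (fun l => by
    by_cases hl : l = j
    · subst hl; simpa using hA
    · simp [hl])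
  have h2 : {ω | S ω ∈ B ∧ ∀ l, a l ω ∈ Function.update (fun _ => Set.univ) j A l} =
      {ω | S ω ∈ B ∧ a j ω ∈ A} := by
    ext ω
    simp only [Set.mem_ofPred_eq]
    refine and_congr_right fun _ => ⟨fun hl => by simpa using hl j, fun hj l => ?_⟩
    by_cases hl : l = j
    · subst hl; simpa using hj
    · simp [hl]
  rw [← h2, h1, ← lintegral_zero (μ := P.restrict (S ⁻¹' B))]
  refine setLIntegral_congr_fun (hS hB) fun ω hω => ?_
  exact Finset.prod_eq_zero (Finset.mem_univ j) (by simpa using h0 _ hω)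

theorem IsSphereSample.ae_norm_eq_one (hS : Measurable S) (h : IsSphereSample P S a) (j : Fin s) :
    ∀ᵐ ω ∂P, ‖a j ω‖ = 1 := by
  have hA : MeasurableSet {x : EuclideanSpace ℝ (Fin D) | ‖x‖ ≠ 1} :=
    (isClosed_eq continuous_norm continuous_const).measurableSet.compl
  have := h.measure_eq_zero hS j MeasurableSet.univ hA fun S _ =>
    uniformOnSphere_eq_zero_of_forall hA fun x _ hx => by simpa using hx
  rw [ae_iff]
  simpa using this

/-- A unit vector `x` outside `S` is detected by some `g` of a countable dense set, for which
`⟪x, g⟫` exceeds the norm of the projection of `g` to `S`. -/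
theorem IsSphereSample.ae_mem (hS : Measurable S) (h : IsSphereSample P S a) (j : Fin s) :
    ∀ᵐ ω ∂P, a j ω ∈ S ω := by
  have key : ∀ (m : ℕ) (r : ℚ), ∀ᵐ ω ∂P,
      ¬ (‖(S ω).starProjection (TopologicalSpace.denseSeq (EuclideanSpace ℝ (Fin D)) m)‖ < r ∧
        (r : ℝ) < inner ℝ (a j ω) (TopologicalSpace.denseSeq (EuclideanSpace ℝ (Fin D)) m)) := by
    intro m r
    set g := TopologicalSpace.denseSeq (EuclideanSpace ℝ (Fin D)) m
    have hB : MeasurableSet {S : Submodule ℝ (EuclideanSpace ℝ (Fin D)) |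
        ‖S.starProjection g‖ < r} :=
      measurableSet_lt (measurable_starProjection_apply.comp
        (measurable_id.prodMk measurable_const)).norm measurable_const
    have hA : MeasurableSet {x : EuclideanSpace ℝ (Fin D) | (r : ℝ) < inner ℝ x g} :=
      (isOpen_lt continuous_const (by fun_prop)).measurableSet
    have := h.measure_eq_zero hS j hB hA fun S hSB =>
      uniformOnSphere_eq_zero_of_forall hA fun x hxS hx hxA => by
        have h1 := real_inner_le_norm x (S.starProjection g)
        rw [inner_starProjection_of_mem hxS, hx, one_mul] at h1
        exact lt_irrefl _ ((hxA.trans_le h1).trans hSB)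
    rw [ae_iff]
    simpa using this
  have key' := ae_all_iff.2 fun m => ae_all_iff.2 (key m)
  filter_upwards [key'] with ω hω
  by_contra hmem
  set y := a j ω - (S ω).starProjection (a j ω) with hy
  have hy0 : y ≠ 0 := fun h0 => hmem ((S ω).starProjection_eq_self_iff.1 (sub_eq_zero.1 h0).symm)
  have hyO : y ∈ (S ω)ᗮ := (S ω).sub_starProjection_mem_orthogonal _
  have h1 : (S ω).starProjection y = 0 := ((S ω).starProjection_apply_eq_zero_iff).2 hyO
  have h2 : inner ℝ (a j ω) y = ‖y‖ ^ 2 := by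
    have : a j ω = y + (S ω).starProjection (a j ω) := by rw [hy]; abel
    rw [this, inner_add_left, real_inner_self_eq_norm_sq,
      Submodule.inner_right_of_mem_orthogonal ((S ω).starProjection_apply_mem _) hyO, add_zero]
  have hopen : IsOpen {g | ‖(S ω).starProjection g‖ < inner ℝ (a j ω) g} :=
    isOpen_lt (by fun_prop) (by fun_prop)
  obtain ⟨m, hm⟩ := (TopologicalSpace.denseRange_denseSeq _).exists_mem_open hopen
    ⟨y, by
      have := norm_pos_iff.2 hy0
      simp only [Set.mem_ofPred_eq, h1, norm_zero, h2]
      positivity⟩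
  obtain ⟨r, hr1, hr2⟩ := exists_rat_btwn (Set.mem_ofPred_eq ▸ hm : _ < _)
  exact hω m r ⟨hr1, hr2⟩

/-- For a fixed vector `g`, the probability that all points `a j ω` avoid the double cap of angle
`β` around the projection of `g` to `S ω`. The length of this projection varies with `S ω`; it is
localized in geometric intervals, and on each of them the avoided cap contains a set depending on
`g` only, which in turn contains the double cap of angle `α < β`. -/
theorem IsSphereSample.measure_forall_abs_inner_lt_le [IsProbabilityMeasure P] (hS : Measurable S)
    (h : IsSphereSample P S a) (hs : 0 < s) {d : ℕ} (hd : 2 ≤ d)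
    (hfin : ∀ᵐ ω ∂P, finrank ℝ (S ω) = d)
    {α β : ℝ} (hα : 0 < α) (hαβ : α < β) (hβ : β < Real.pi / 2) (g : EuclideanSpace ℝ (Fin D)) :
    P {ω | ∀ j, |inner ℝ (a j ω) g| < Real.cos β * ‖(S ω).starProjection g‖} ≤
      (1 - ENNReal.ofReal (capBound d α)) ^ s := by
  have hcβ : 0 < Real.cos β := Real.cos_pos_of_mem_Ioo ⟨by linarith, hβ⟩
  have hcos : Real.cos β < Real.cos α :=
    Real.cos_lt_cos_of_nonneg_of_le_pi hα.le (by linarith [Real.pi_pos]) hαβ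
  set c := Real.cos α / Real.cos β with hc
  have hc1 : 1 < c := (one_lt_div hcβ).2 hcos
  have hc0 : 0 < c := by linarith
  set q := 1 - ENNReal.ofReal (capBound d α) with hq
  set B : ℤ → Set (Submodule ℝ (EuclideanSpace ℝ (Fin D))) := fun m =>
    {T | ‖T.starProjection g‖ ∈ Set.Ico (c ^ m) (c ^ (m + 1))} with hB
  set A : ℤ → Set (EuclideanSpace ℝ (Fin D)) := fun m =>
    {x | |inner ℝ x g| < Real.cos β * c ^ (m + 1)} with hA
  have hBm : ∀ m, MeasurableSet (B m) := fun m =>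
    (measurable_starProjection_apply.comp (measurable_id.prodMk measurable_const)).norm
      measurableSet_Ico
  have hAm : ∀ m, MeasurableSet (A m) := fun m =>
    (isOpen_lt (by fun_prop) continuous_const).measurableSet
  have hdisj : Pairwise (Function.onFun Disjoint fun m => S ⁻¹' B m) := by
    intro m l hml
    refine Set.disjoint_left.2 fun ω h1 h2 => hml ?_
    simp only [hB, Set.mem_preimage, Set.mem_ofPred_eq, Set.mem_Ico] at h1 h2
    have h3 := (zpow_lt_zpow_iff_right₀ hc1).1 (h1.1.trans_lt h2.2)
    have h4 := (zpow_lt_zpow_iff_right₀ hc1).1 (h2.1.trans_lt h1.2)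
    omega
  have hpiece : ∀ m, P {ω | S ω ∈ B m ∧ ∀ j, a j ω ∈ A m} ≤ q ^ s * P (S ⁻¹' B m) := by
    intro m
    rw [h (B m) (hBm m) (fun _ => A m) fun _ => hAm m]
    calc _ ≤ ∫⁻ _ in S ⁻¹' B m, q ^ s ∂P := by
          refine lintegral_mono_ae ?_
          filter_upwards [ae_restrict_of_ae hfin, ae_restrict_mem (hS (hBm m))] with ω hω hωB
          have hωB' : c ^ m ≤ ‖(S ω).starProjection g‖ := hωB.1
          have hg0 : (S ω).starProjection g ≠ 0 :=
            norm_pos_iff.1 ((zpow_pos hc0 m).trans_le hωB')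
          rw [Finset.prod_const, Finset.card_univ, Fintype.card_fin]
          gcongr
          refine le_trans (measure_mono fun x hx => ?_) (uniformOnSphere_le_one_sub_capBound hd hω
            hα (hαβ.trans hβ) hg0)
          simp only [hA, Set.mem_ofPred_eq] at hx ⊢
          refine hx.trans_le ?_
          rw [zpow_add_one₀ hc0.ne', ← mul_assoc, mul_right_comm, hc, mul_div_cancel₀ _ hcβ.ne']
          gcongr
          exact Real.cos_nonneg_of_mem_Icc ⟨by linarith, by linarith⟩
      _ = _ := by simp
  calc _ ≤ P (⋃ m, {ω | S ω ∈ B m ∧ ∀ j, a j ω ∈ A m}) := by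
        refine measure_mono fun ω hω => ?_
        have hpos : 0 < ‖(S ω).starProjection g‖ := by
          have h1 := (abs_nonneg _).trans_lt (hω ⟨0, hs⟩)
          exact pos_of_mul_pos_right h1 hcβ.le
        obtain ⟨m, hm⟩ := exists_mem_Ico_zpow hpos hc1
        refine Set.mem_iUnion.2 ⟨m, hm, fun j => (hω j).trans_le ?_⟩
        gcongr
        exact hm.2.le
    _ ≤ ∑' m, P {ω | S ω ∈ B m ∧ ∀ j, a j ω ∈ A m} := measure_iUnion_le _
    _ ≤ ∑' m, q ^ s * P (S ⁻¹' B m) := ENNReal.tsum_le_tsum hpiece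
    _ = q ^ s * P (⋃ m, S ⁻¹' B m) := by
        rw [ENNReal.tsum_mul_left, measure_iUnion hdisj fun m => hS (hBm m)]
    _ ≤ q ^ s * 1 := by gcongr; exact prob_le_one
    _ = q ^ s := mul_one _

/-- The triangle inequality for angles, for lines: if `z` is within angle `γ` of the line of `w` and
`a` is at an angle of more than `β + γ` from it, then `a` is at an angle of more than `β` from the
line of `z`. -/
theorem abs_inner_lt_of_cone {F : Type*} [NormedAddCommGroup F] [InnerProductSpace ℝ F]
    {a w z : F} (ha : ‖a‖ = 1) (hw : ‖w‖ = 1) (hz : z ≠ 0) {β γ : ℝ} (hβ : 0 ≤ β) (hγ : 0 ≤ γ)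
    (hβγ : β + γ ≤ Real.pi) (hwz : Real.cos γ * ‖z‖ ≤ |inner ℝ w z|)
    (haw : |inner ℝ a w| < Real.cos (β + γ)) : |inner ℝ a z| < Real.cos β * ‖z‖ := by
  by_contra! hcon
  have hzn : 0 < ‖z‖ := norm_pos_iff.2 hz
  have main : ∀ a w : F, ‖a‖ = 1 → ‖w‖ = 1 → |inner ℝ a w| < Real.cos (β + γ) →
      Real.cos γ * ‖z‖ ≤ inner ℝ w z → Real.cos β * ‖z‖ ≤ inner ℝ a z → False := by
    intro a w ha hw haw hwz haz
    have angle_le : ∀ (v : F) (δ : ℝ), ‖v‖ = 1 → 0 ≤ δ → δ ≤ Real.pi →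
        Real.cos δ * ‖z‖ ≤ inner ℝ v z → InnerProductGeometry.angle v z ≤ δ := by
      intro v δ hv h0 h1 h
      rw [InnerProductGeometry.angle, hv, one_mul, ← Real.arccos_cos h0 h1]
      exact Real.antitone_arccos ((le_div_iff₀ hzn).2 h)
    have h1 := angle_le a β ha hβ (by linarith) haz
    have h2 := angle_le w γ hw hγ (by linarith) hwz
    have h3 := InnerProductGeometry.angle_le_angle_add_angle a z w
    rw [InnerProductGeometry.angle_comm z w] at h3
    have h4 := Real.cos_le_cos_of_nonneg_of_le_pi (InnerProductGeometry.angle_nonneg a w) hβγ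
      (by linarith)
    rw [InnerProductGeometry.cos_angle, ha, hw, mul_one, div_one] at h4
    linarith [le_abs_self (inner ℝ a w)]
  rcases le_abs.1 hwz with h1 | h1 <;> rcases le_abs.1 hcon with h2 | h2
  · exact main a w ha hw haw h1 h2
  · exact main (-a) w (by simpa) hw (by simpa) h1 (by simpa)
  · exact main a (-w) ha (by simpa) (by simpa) (by simpa) h2
  · exact main (-a) (-w) (by simpa) (by simpa) (by simpa) (by simpa) (by simpa)

/-- The probability that some direction of `S ω` is at an angle of more than `α + γ` from all the
lines of the points `a j ω`. A bad direction `w` makes all directions within angle `γ` of `w` avoid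
the points at some angle `β > α`; by Markov's inequality, the probability of a bad direction is at
most the probability that a uniform random direction is avoided, divided by the area of the cap of
angle `γ`. This replaces a union bound over a net of directions. -/
theorem IsSphereSample.measure_exists_direction_le [IsProbabilityMeasure P] (hS : Measurable S)
    (ha : ∀ j, Measurable (a j)) (h : IsSphereSample P S a) (hs : 0 < s) {d : ℕ} (hd : 2 ≤ d)
    (hfin : ∀ᵐ ω ∂P, finrank ℝ (S ω) = d) {α β γ : ℝ} (hα : 0 < α) (hαβ : α < β) (hγ : 0 < γ)
    (hβγ : β + γ < Real.pi / 2) :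
    ENNReal.ofReal (capBound d γ) *
      P {ω | ∃ w ∈ S ω, ‖w‖ = 1 ∧ ∀ j, |inner ℝ (a j ω) w| < Real.cos (β + γ)} ≤
      (1 - ENNReal.ofReal (capBound d α)) ^ s := by
  set V := ball (0 : EuclideanSpace ℝ (Fin D)) 1 with hV
  set q := 1 - ENNReal.ofReal (capBound d α) with hq
  set H : Set (Ω × EuclideanSpace ℝ (Fin D)) :=
    {p | ∀ j, |inner ℝ (a j p.1) p.2| < Real.cos β * ‖(S p.1).starProjection p.2‖} with hH
  have hHm : MeasurableSet H := by
    rw [hH, Set.ofPred_forall]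
    refine MeasurableSet.iInter fun j => measurableSet_lt ?_ ?_
    · have h1 : Measurable fun p : Ω × EuclideanSpace ℝ (Fin D) => (inner ℝ (a j p.1) p.2 : ℝ) :=
        ((ha j).comp measurable_fst).inner measurable_snd
      exact h1.abs
    · exact (measurable_starProjection_apply.comp
        ((hS.comp measurable_fst).prodMk measurable_snd)).norm.const_mul _
  have hmarkov := mul_meas_ge_le_lintegral (μ := P)
    (measurable_measure_prodMk_left (ν := volume.restrict V) hHm)
    (ENNReal.ofReal (capBound d γ) * volume V)
  rw [← Measure.prod_apply hHm, Measure.prod_apply_symm hHm] at hmarkov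
  have hbad : P {ω | ∃ w ∈ S ω, ‖w‖ = 1 ∧ ∀ j, |inner ℝ (a j ω) w| < Real.cos (β + γ)} ≤
      P {ω | ENNReal.ofReal (capBound d γ) * volume V ≤
        (volume.restrict V) (Prod.mk ω ⁻¹' H)} := by
    refine measure_mono_ae ?_
    filter_upwards [hfin, ae_all_iff.2 (h.ae_mem hS), ae_all_iff.2 (h.ae_norm_eq_one hS)]
      with ω hω hmem hnorm hw
    obtain ⟨w, hwS, hw1, hwa⟩ := hw
    refine (capBound_mul_volume_ball_le hd hω hγ (by linarith) hwS hw1).trans ?_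
    rw [Measure.restrict_apply (measurable_prodMk_left hHm)]
    have hnull : volume ((S ω)ᗮ : Set (EuclideanSpace ℝ (Fin D))) = 0 := by
      refine Measure.addHaar_submodule _ _ fun htop => ?_
      rw [Submodule.orthogonal_eq_top_iff] at htop
      rw [htop, finrank_bot] at hω
      omega
    rw [← measure_sdiff_null hnull]
    refine measure_mono ?_
    rintro g ⟨⟨hg1, hg2⟩, hg3⟩
    refine ⟨fun j => ?_, hg1⟩
    have hz : (S ω).starProjection g ≠ 0 := fun h0 =>
      hg3 (((S ω).starProjection_apply_eq_zero_iff).1 h0)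
    rw [← inner_starProjection_of_mem (hmem j)]
    rw [← inner_starProjection_of_mem hwS] at hg2
    exact abs_inner_lt_of_cone (hnorm j) hw1 hz (by linarith) hγ.le (by linarith [Real.pi_pos])
      hg2 (hwa j)
  have hV0 : volume V ≠ 0 := (measure_ball_pos volume _ one_pos).ne'
  have hVt : volume V ≠ ⊤ := measure_ball_lt_top.ne
  refine (ENNReal.mul_le_mul_iff_left hV0 hVt).1 ?_
  calc _ = ENNReal.ofReal (capBound d γ) * volume V *
        P {ω | ∃ w ∈ S ω, ‖w‖ = 1 ∧ ∀ j, |inner ℝ (a j ω) w| < Real.cos (β + γ)} := by ring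
    _ ≤ _ := (mul_le_mul_right hbad _).trans hmarkov
    _ ≤ ∫⁻ _, q ^ s ∂(volume.restrict V) := by
        refine lintegral_mono fun g => ?_
        exact h.measure_forall_abs_inner_lt_le hS hs hd hfin hα hαβ (by linarith) g
    _ = q ^ s * volume V := by simp

end Samples

/-! ### Ratios of ball volumes and the constant -/

section Constant

theorem unitBallVol_add_two (p : ℕ) :
    unitBallVol (p + 2) = 2 * Real.pi / (p + 2) * unitBallVol p := by
  unfold unitBallVol
  have h1 : ((p + 2 : ℕ) : ℝ) / 2 = p / 2 + 1 := by push_cast; ring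
  have hg : 0 < Real.Gamma ((p : ℝ) / 2 + 1) := Real.Gamma_pos_of_pos (by positivity)
  rw [h1, Real.rpow_add_one Real.pi_ne_zero, Real.Gamma_add_one (by positivity)]
  field_simp

/-- The ratio `v_{k+1} / v_k`. -/
noncomputable def ballRatio (k : ℕ) : ℝ := unitBallVol (k + 1) / unitBallVol k

theorem ballRatio_pos (k : ℕ) : 0 < ballRatio k := div_pos (unitBallVol_pos _) (unitBallVol_pos _)

theorem ballRatio_mul_succ (k : ℕ) : ballRatio k * ballRatio (k + 1) = 2 * Real.pi / (k + 2) := by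
  have := unitBallVol_pos k
  have := unitBallVol_pos (k + 1)
  rw [ballRatio, ballRatio, unitBallVol_add_two]
  field_simp

/-- By logarithmic convexity of the Gamma function. -/
theorem ballRatio_succ_le (k : ℕ) : ballRatio (k + 1) ≤ ballRatio k := by
  have h0 := unitBallVol_pos k
  have h1 := unitBallVol_pos (k + 1)
  rw [ballRatio, ballRatio, div_le_div_iff₀ h1 h0]
  have hx : (0 : ℝ) < k / 2 + 1 := by positivity
  have hx2 : (0 : ℝ) < k / 2 + 2 := by positivity
  have hconv := Real.Gamma_mul_add_mul_le_rpow_Gamma_mul_rpow_Gamma hx hx2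
    (a := 1 / 2) (b := 1 / 2) (by norm_num) (by norm_num) (by norm_num)
  have hg0 : 0 < Real.Gamma ((k : ℝ) / 2 + 1) := Real.Gamma_pos_of_pos hx
  have hg2 : 0 < Real.Gamma ((k : ℝ) / 2 + 2) := Real.Gamma_pos_of_pos hx2
  have hg1 : 0 < Real.Gamma ((k : ℝ) / 2 + 3 / 2) := Real.Gamma_pos_of_pos (by positivity)
  have hmid : 1 / 2 * ((k : ℝ) / 2 + 1) + 1 / 2 * (k / 2 + 2) = k / 2 + 3 / 2 := by ring
  rw [hmid, ← Real.mul_rpow hg0.le hg2.le, ← Real.sqrt_eq_rpow] at hconv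
  have hsq : Real.Gamma ((k : ℝ) / 2 + 3 / 2) * Real.Gamma ((k : ℝ) / 2 + 3 / 2) ≤
      Real.Gamma ((k : ℝ) / 2 + 1) * Real.Gamma ((k : ℝ) / 2 + 2) := by
    rw [← sq]
    exact (Real.le_sqrt' hg1).1 hconv
  have e1 : ((k + 1 : ℕ) : ℝ) / 2 + 1 = k / 2 + 3 / 2 := by push_cast; ring
  have e2 : ((k + 1 + 1 : ℕ) : ℝ) / 2 + 1 = k / 2 + 2 := by push_cast; ring
  have p1 : Real.pi ^ (((k + 1 + 1 : ℕ) : ℝ) / 2) * Real.pi ^ ((k : ℝ) / 2) =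
      Real.pi ^ (((k + 1 : ℕ) : ℝ) / 2) * Real.pi ^ (((k + 1 : ℕ) : ℝ) / 2) := by
    rw [← Real.rpow_add Real.pi_pos, ← Real.rpow_add Real.pi_pos]
    congr 1; push_cast; ring
  unfold unitBallVol
  rw [e1, e2, div_mul_div_comm, div_mul_div_comm, p1, mul_comm (Real.Gamma (k / 2 + 2))]
  gcongr

theorem le_ballRatio_sq (k : ℕ) : 2 * Real.pi / (k + 2) ≤ ballRatio k ^ 2 := by
  rw [← ballRatio_mul_succ, sq]
  exact mul_le_mul_of_nonneg_left (ballRatio_succ_le k) (ballRatio_pos k).le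

theorem ballRatio_succ_sq_le (k : ℕ) : ballRatio (k + 1) ^ 2 ≤ 2 * Real.pi / (k + 2) := by
  rw [← ballRatio_mul_succ, sq]
  exact mul_le_mul_of_nonneg_right (ballRatio_succ_le k) (ballRatio_pos _).le

theorem ballRatio_add_two (k : ℕ) : ballRatio (k + 2) = (k + 2) / (k + 3) * ballRatio k := by
  have h1 := ballRatio_mul_succ k
  have h2 := ballRatio_mul_succ (k + 1)
  push_cast at h2
  have h3 := ballRatio_pos (k + 1)
  have hp := Real.pi_pos
  rw [mul_comm] at h2
  have e2 : ballRatio (k + 2) = 2 * Real.pi / (k + 1 + 2) / ballRatio (k + 1) :=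
    eq_div_of_mul_eq h3.ne' h2
  have e1 : ballRatio k = 2 * Real.pi / (k + 2) / ballRatio (k + 1) := eq_div_of_mul_eq h3.ne' h1
  rw [e1, e2]
  field_simp
  ring

/-- The sequence `(k + 3/2) (v_{k+1} / v_k)²` increases along every second index, and its limit
is `2π`. -/
theorem ballRatio_sq_le (k : ℕ) : ballRatio k ^ 2 ≤ 2 * Real.pi / (k + 3 / 2) := by
  have step : ∀ k : ℕ, ballRatio k ^ 2 * (k + 3 / 2) ≤
      ballRatio (k + 2) ^ 2 * ((k + 2 : ℕ) + 3 / 2) := by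
    intro k
    rw [ballRatio_add_two, mul_pow, mul_comm (_ ^ 2) (ballRatio k ^ 2), mul_assoc]
    refine mul_le_mul_of_nonneg_left ?_ (sq_nonneg _)
    have hk : (0 : ℝ) ≤ k := Nat.cast_nonneg k
    rw [div_pow, div_mul_eq_mul_div, le_div_iff₀ (by positivity)]
    push_cast
    nlinarith
  have iter : ∀ m : ℕ, ballRatio k ^ 2 * (k + 3 / 2) ≤
      ballRatio (k + 2 * m) ^ 2 * ((k + 2 * m : ℕ) + 3 / 2) := by
    intro m
    induction m with
    | zero => simp
    | succ m ih => exact ih.trans (step (k + 2 * m))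
  have bound : ∀ m : ℕ, ballRatio k ^ 2 * (k + 3 / 2) ≤ 2 * Real.pi + Real.pi / (m + 1 : ℝ) := by
    intro m
    refine (iter (m + 1)).trans ?_
    have h := ballRatio_succ_sq_le (k + 2 * m + 1)
    have e : k + 2 * (m + 1) = k + 2 * m + 1 + 1 := by ring
    rw [e]
    have hp := Real.pi_pos
    have hk : (0 : ℝ) ≤ k := Nat.cast_nonneg k
    have hm : (0 : ℝ) ≤ m := Nat.cast_nonneg m
    calc _ ≤ 2 * Real.pi / ((k + 2 * m + 1 : ℕ) + 2) * ((k + 2 * m + 1 + 1 : ℕ) + 3 / 2) := by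
          gcongr
      _ = 2 * Real.pi + Real.pi / ((k + 2 * m + 1 : ℕ) + 2) := by
          push_cast
          field_simp
          ring
      _ ≤ _ := by
          refine add_le_add_right (div_le_div_of_nonneg_left hp.le (by positivity) ?_) _
          push_cast
          linarith
  rw [le_div_iff₀ (by positivity)]
  refine ge_of_tendsto' (f := fun m : ℕ => 2 * Real.pi + Real.pi / ((m : ℝ) + 1)) (x := Filter.atTop) ?_ bound
  have := (tendsto_one_div_add_atTop_nhds_zero_nat (𝕜 := ℝ)).const_mul Real.pi
  simpa [div_eq_mul_inv] using this.const_add (2 * Real.pi)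

theorem ballRatio_lt_one {k : ℕ} (hk : 5 ≤ k) : ballRatio k < 1 := by
  have h := ballRatio_sq_le k
  have hk' : (5 : ℝ) ≤ k := by exact_mod_cast hk
  have : 2 * Real.pi / (k + 3 / 2) < 1 := by
    rw [div_lt_one (by positivity)]
    linarith [Real.pi_lt_d2]
  rw [← sq_lt_one_iff₀ (ballRatio_pos k).le]
  exact h.trans_lt this

/-- The sequence `(v_{k+1} / v_k)^{1/k}` is strictly increasing from `k = 14` on. -/
theorem ballRatio_pow_lt {k : ℕ} (hk : 14 ≤ k) : ballRatio k ^ (k + 1) < ballRatio (k + 1) ^ k := by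
  have hr := ballRatio_pos k
  have hr1 := ballRatio_pos (k + 1)
  have hk' : (14 : ℝ) ≤ k := by exact_mod_cast hk
  have hp := Real.pi_pos
  have hsq := ballRatio_sq_le k
  -- `x = v_{k+1}² / (v_k v_{k+2})`
  set x := ballRatio k / ballRatio (k + 1) with hx
  have hx0 : 0 < x := div_pos hr hr1
  have hxe : x = ballRatio k ^ 2 * (k + 2) / (2 * Real.pi) := by
    have h := ballRatio_mul_succ k
    have : ballRatio (k + 1) = 2 * Real.pi / (k + 2) / ballRatio k :=
      eq_div_of_mul_eq hr.ne' (by rw [mul_comm]; exact h)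
    rw [hx, this]
    field_simp
  have hxle : x ≤ 1 + 1 / (2 * k + 3) := by
    rw [hxe]
    calc _ ≤ 2 * Real.pi / (k + 3 / 2) * (k + 2) / (2 * Real.pi) := by gcongr
      _ = _ := by field_simp; ring
  have key : (1 + 1 / (2 * k + 3) : ℝ) ^ (2 * k) * (2 * Real.pi / (k + 3 / 2)) < 1 := by
    have hpi := Real.pi_lt_d4
    -- From `k = 16` on, `(1 + 1 / (2 * k + 3)) ^ (2 * k) ≤ e` is enough.
    rcases (by omega : k = 14 ∨ k = 15 ∨ 16 ≤ k) with rfl | rfl | h16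
    · push_cast
      rw [← mul_div_assoc, div_lt_one (by norm_num)]
      norm_num at *
      nlinarith
    · push_cast
      rw [← mul_div_assoc, div_lt_one (by norm_num)]
      norm_num at *
      nlinarith
    · have h16' : (16 : ℝ) ≤ k := by exact_mod_cast h16
      have hexp : (1 + 1 / (2 * k + 3) : ℝ) ^ (2 * k) ≤ Real.exp 1 := by
        calc (1 + 1 / (2 * k + 3) : ℝ) ^ (2 * k) ≤ Real.exp (1 / (2 * k + 3)) ^ (2 * k) := by
              gcongr
              rw [add_comm]
              exact Real.add_one_le_exp _
          _ = Real.exp ((2 * k : ℕ) * (1 / (2 * k + 3))) := by rw [Real.exp_nat_mul]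
          _ ≤ Real.exp 1 := by
              rw [Real.exp_le_exp]
              push_cast
              rw [mul_one_div, div_le_one (by positivity)]
              linarith
      calc _ ≤ Real.exp 1 * (2 * Real.pi / (k + 3 / 2)) := by gcongr
        _ < 1 := by
          rw [← mul_div_assoc, div_lt_one (by positivity)]
          have := Real.exp_one_lt_d9
          nlinarith
  have hlt : (x ^ k * ballRatio k) ^ 2 < 1 := by
    calc (x ^ k * ballRatio k) ^ 2 = x ^ (2 * k) * ballRatio k ^ 2 := by ring
      _ ≤ (1 + 1 / (2 * k + 3) : ℝ) ^ (2 * k) * (2 * Real.pi / (k + 3 / 2)) := by gcongr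
      _ < 1 := key
  have hlt' : x ^ k * ballRatio k < 1 := (sq_lt_one_iff₀ (by positivity)).1 hlt
  rw [hx, div_pow, div_mul_eq_mul_div, div_lt_one (by positivity)] at hlt'
  rwa [pow_succ]

theorem srcConst_eq (k d : ℕ) (hd : 1 ≤ d) : srcConst (k + 1) d =
    1 / 2 ^ (d - 2) / ballRatio (d - 1) * ballRatio k ^ (((d : ℝ) - 1) / k) := by
  obtain ⟨e, rfl⟩ : ∃ e, d = e + 1 := ⟨d - 1, by omega⟩
  have := unitBallVol_pos e
  have := unitBallVol_pos (e + 1)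
  simp only [srcConst, ballRatio, Nat.add_sub_cancel]
  congr 1
  · field_simp
  · congr 1; push_cast; ring

theorem srcConst_lt_succ {D d : ℕ} (hD : 15 ≤ D) (hd : 2 ≤ d) :
    srcConst D d < srcConst (D + 1) d := by
  obtain ⟨k, rfl⟩ : ∃ k, D = k + 1 := ⟨D - 1, by omega⟩
  rw [srcConst_eq k d (by omega), srcConst_eq (k + 1) d (by omega)]
  have hk : (0 : ℝ) < k := by exact_mod_cast (by omega : 0 < k)
  have hd' : (2 : ℝ) ≤ d := by exact_mod_cast hd
  refine mul_lt_mul_of_pos_left ?_ (div_pos (by positivity) (ballRatio_pos _))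
  have h := Real.rpow_lt_rpow (pow_nonneg (ballRatio_pos k).le _)
    (ballRatio_pow_lt (by omega : 14 ≤ k))
    (z := ((d : ℝ) - 1) / (k * (k + 1))) (by apply div_pos <;> nlinarith)
  rw [← Real.rpow_natCast, ← Real.rpow_natCast, ← Real.rpow_mul (ballRatio_pos _).le,
    ← Real.rpow_mul (ballRatio_pos _).le] at h
  have e1 : ((k + 1 : ℕ) : ℝ) * (((d : ℝ) - 1) / (k * (k + 1))) = ((d : ℝ) - 1) / k := by
    push_cast; field_simp
  have e2 : (k : ℝ) * (((d : ℝ) - 1) / (k * (k + 1))) = ((d : ℝ) - 1) / (k + 1 : ℕ) := by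
    push_cast; field_simp
  rwa [e1, e2] at h

theorem srcConst_strictMono {D D' d : ℕ} (hD : 15 ≤ D) (hd : 2 ≤ d) (h : D < D') :
    srcConst D d < srcConst D' d := by
  induction D', h using Nat.le_induction with
  | base => exact srcConst_lt_succ hD hd
  | succ D' h ih => exact ih.trans (srcConst_lt_succ (by omega) hd)

theorem srcConst_succ_lt {D d : ℕ} (hD : 15 ≤ D) (hd : 2 ≤ d) :
    srcConst D (d + 1) < srcConst D d := by
  obtain ⟨k, rfl⟩ : ∃ k, D = k + 1 := ⟨D - 1, by omega⟩
  obtain ⟨e, rfl⟩ : ∃ e, d = e + 2 := ⟨d - 2, by omega⟩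
  rw [srcConst_eq k _ (by omega), srcConst_eq k _ (by omega)]
  have hk : (0 : ℝ) < k := by exact_mod_cast (by omega : 0 < k)
  have hr := ballRatio_pos k
  have ha := ballRatio_pos (e + 1)
  have hb := ballRatio_pos (e + 2)
  have hp := Real.pi_pos
  have he : (0 : ℝ) ≤ e := Nat.cast_nonneg e
  have hlt : ballRatio (e + 1) < 2 * ballRatio (e + 2) := by
    have h1 := ballRatio_mul_succ (e + 1)
    have h2 := ballRatio_sq_le (e + 1)
    refine lt_of_mul_lt_mul_left ?_ ha.le
    rw [mul_left_comm, h1, ← sq]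
    refine h2.trans_lt ?_
    push_cast
    rw [← mul_div_assoc, div_lt_div_iff₀ (by positivity) (by positivity)]
    nlinarith
  have e1 : e + 2 + 1 - 2 = e + 1 := by omega
  have e2 : e + 2 + 1 - 1 = e + 2 := by omega
  have e3 : e + 2 - 2 = e := by omega
  have e4 : e + 2 - 1 = e + 1 := by omega
  rw [e1, e2, e3, e4]
  have hpow : ballRatio k ^ ((((e + 2 + 1 : ℕ) : ℝ) - 1) / k) ≤
      ballRatio k ^ ((((e + 2 : ℕ) : ℝ) - 1) / k) := by
    refine Real.rpow_le_rpow_of_exponent_ge hr (ballRatio_lt_one (by omega)).le ?_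
    refine div_le_div_of_nonneg_right ?_ hk.le
    push_cast
    linarith
  refine mul_lt_mul_of_lt_of_le_of_nonneg_of_pos ?_ hpow (by positivity) (by positivity)
  rw [div_div, div_div, div_lt_div_iff_of_pos_left one_pos (by positivity) (by positivity), pow_succ]
  have : (0 : ℝ) < 2 ^ e := by positivity
  nlinarith

theorem srcConst_strictAnti {D d d' : ℕ} (hD : 15 ≤ D) (hd : 2 ≤ d) (h : d < d') :
    srcConst D d' < srcConst D d := by
  induction d', h using Nat.le_induction with
  | base => exact srcConst_succ_lt hD hd
  | succ d' h ih => exact (srcConst_succ_lt hD (by omega)).trans ih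

/-- The value of `srcConst` with the factor depending on `D` removed. -/
theorem srcConst_le {D d : ℕ} (hD : 15 ≤ D) (hd : 2 ≤ d) :
    srcConst D d ≤ 1 / 2 ^ (d - 2) / ballRatio (d - 1) := by
  obtain ⟨k, rfl⟩ : ∃ k, D = k + 1 := ⟨D - 1, by omega⟩
  rw [srcConst_eq k _ (by omega)]
  have hd' : (2 : ℝ) ≤ d := by exact_mod_cast hd
  refine mul_le_of_le_one_right (div_nonneg (by positivity) (ballRatio_pos _).le) ?_
  exact Real.rpow_le_one (ballRatio_pos k).le (ballRatio_lt_one (by omega)).le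
    (div_nonneg (by linarith) (Nat.cast_nonneg _))

/-- The growth of `k + 2` is compared with that of `2π * 1.035 ^ (2 * k)`; the inequality is almost
sharp at `k = 14`. -/
theorem le_ballRatio_rpow {k d : ℕ} (hk : 14 ≤ k) (hd : 2 ≤ d) :
    1 / 1.035 ^ (d - 1) ≤ ballRatio k ^ (((d : ℝ) - 1) / k) := by
  have hgrow : ∀ k : ℕ, 14 ≤ k → (k + 2 : ℝ) ≤ 2 * Real.pi * (1.035 ^ k) ^ 2 := by
    intro k hk
    induction k, hk using Nat.le_induction with
    | base =>
      have := Real.pi_gt_d4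
      norm_num at *
      nlinarith
    | succ k hk ih =>
      have hk' : (14 : ℝ) ≤ k := by exact_mod_cast hk
      have e : ((1.035 : ℝ) ^ (k + 1)) ^ 2 = (1.035 ^ k) ^ 2 * 1.071225 := by
        rw [pow_succ (1.035 : ℝ) k, mul_pow]; norm_num
      rw [e, ← mul_assoc]
      push_cast
      nlinarith
  have hk0 : (0 : ℝ) < k := by exact_mod_cast (by omega : 0 < k)
  have hr := ballRatio_pos k
  have hb : 1 / 1.035 ^ k ≤ ballRatio k := by
    refine (sq_le_sq₀ (by positivity) hr.le).1 (le_trans ?_ (le_ballRatio_sq k))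
    rw [div_pow, one_pow, div_le_div_iff₀ (by positivity) (by positivity), one_mul]
    exact hgrow k hk
  have hd' : (2 : ℝ) ≤ d := by exact_mod_cast hd
  refine le_trans (le_of_eq ?_) (Real.rpow_le_rpow (by positivity) hb
    (div_nonneg (by linarith) hk0.le))
  rw [← one_div_pow, ← one_div_pow, ← Real.rpow_natCast, ← Real.rpow_natCast,
    ← Real.rpow_mul (by norm_num)]
  congr 1
  rw [Nat.cast_sub (by omega)]
  field_simp
  simp

theorem sqrt_le_inv_ballRatio {d : ℕ} (hd : 1 ≤ d) :
    √(d + 1 / 2) / √(2 * Real.pi) ≤ 1 / ballRatio (d - 1) := by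
  have hr := ballRatio_pos (d - 1)
  have h := ballRatio_sq_le (d - 1)
  have hp := Real.pi_pos
  rw [Nat.cast_sub hd] at h
  push_cast at h
  rw [← Real.sqrt_div (by positivity)]
  refine Real.sqrt_le_iff.2 ⟨by positivity, ?_⟩
  rw [div_pow, one_pow, div_le_div_iff₀ (by positivity) (by positivity)]
  rw [le_div_iff₀ (by have : (1 : ℝ) ≤ d := by exact_mod_cast hd
                      linarith)] at h
  linarith

/-- Here `2.07 = 2 * 1.035` and `0.79 < 2 / √(2π)`. The summand `1 / 2` leaves room for lowering the
constant when `D < 15`. -/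
theorem le_srcConst {D d : ℕ} (hD : 15 ≤ D) (hd : 2 ≤ d) :
    0.79 * √(d + 1 / 2) / 2.07 ^ (d - 1) ≤ srcConst D d := by
  obtain ⟨k, rfl⟩ : ∃ k, D = k + 1 := ⟨D - 1, by omega⟩
  rw [srcConst_eq k _ (by omega)]
  have h1 := le_ballRatio_rpow (by omega : 14 ≤ k) hd
  have h2 := sqrt_le_inv_ballRatio (by omega : 1 ≤ d)
  have hp : 0.79 / 2 ≤ 1 / √(2 * Real.pi) := by
    rw [div_le_div_iff₀ (by norm_num) (by positivity)]
    have : √(2 * Real.pi) ≤ 2 / 0.79 := by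
      rw [Real.sqrt_le_iff]
      have := Real.pi_lt_d4
      constructor
      · norm_num
      · norm_num at *
        linarith
    calc _ ≤ 0.79 * (2 / 0.79 : ℝ) := by gcongr
      _ = 1 * 2 := by norm_num
  have e : d - 1 = d - 2 + 1 := by omega
  calc 0.79 * √(d + 1 / 2) / 2.07 ^ (d - 1)
      = 1 / 2 ^ (d - 2) * (√(d + 1 / 2) * (0.79 / 2)) * (1 / 1.035 ^ (d - 1)) := by
        have : (2.07 : ℝ) = 2 * 1.035 := by norm_num
        rw [this, mul_pow, e, pow_succ 2]
        field_simp
    _ ≤ 1 / 2 ^ (d - 2) * (√(d + 1 / 2) * (1 / √(2 * Real.pi))) * (1 / 1.035 ^ (d - 1)) := by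
        gcongr
    _ ≤ 1 / 2 ^ (d - 2) * (1 / ballRatio (d - 1)) * ballRatio k ^ (((d : ℝ) - 1) / k) := by
        rw [mul_one_div √((d : ℝ) + 1 / 2)]
        have := ballRatio_pos (d - 1)
        gcongr
    _ = _ := by ring

end Constant

/-! ### The constant for all admissible dimensions -/

section Admissible

/-- The constant of the probability bound. For `D < 15` the condition `2 * d ^ 2 < D` leaves only
`d = 2`; there `srcConst` decreases in `D`, and the value at `D = 15`, lowered linearly in `15 - D`,
takes its place. -/
noncomputable def srcBoundConst (D d : ℕ) : ℝ :=
  if 15 ≤ D then srcConst D d else srcConst 15 d - (15 - D) / 1000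

theorem srcBoundConst_of_le {D : ℕ} (hD : 15 ≤ D) (d : ℕ) : srcBoundConst D d = srcConst D d :=
  if_pos hD

theorem srcBoundConst_strictMono {D D' d : ℕ} (hd : 2 ≤ d) (h : D < D') :
    srcBoundConst D d < srcBoundConst D' d := by
  have h' : (D : ℝ) < D' := by exact_mod_cast h
  by_cases hD : 15 ≤ D
  · rw [srcBoundConst_of_le hD, srcBoundConst_of_le (hD.trans h.le)]
    exact srcConst_strictMono hD hd h
  · have h15 : (D : ℝ) < 15 := by exact_mod_cast not_le.1 hD
    rw [srcBoundConst, if_neg hD]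
    by_cases hD' : 15 ≤ D'
    · rw [srcBoundConst_of_le hD']
      rcases hD'.eq_or_lt with rfl | hlt
      · linarith
      · have := srcConst_strictMono le_rfl hd hlt
        linarith
    · rw [srcBoundConst, if_neg hD']
      linarith

theorem eq_two_of_lt_fifteen {D d : ℕ} (hd : 2 ≤ d) (hdD : 2 * d ^ 2 < D) (hD : D < 15) :
    d = 2 := by
  by_contra hne
  have : 3 ≤ d := by omega
  nlinarith

theorem srcBoundConst_strictAnti {D d d' : ℕ} (hd : 2 ≤ d) (h : d < d') (hD : 2 * d' ^ 2 < D) :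
    srcBoundConst D d' < srcBoundConst D d := by
  have hD15 : 15 ≤ D := by
    by_contra hlt
    have := eq_two_of_lt_fifteen (by omega) hD (not_le.1 hlt)
    omega
  rw [srcBoundConst_of_le hD15, srcBoundConst_of_le hD15]
  exact srcConst_strictAnti hD15 hd h

theorem le_srcBoundConst {D d : ℕ} (hd : 2 ≤ d) (hD : 2 * d ^ 2 < D) :
    0.79 * √d / 2.07 ^ (d - 1) ≤ srcBoundConst D d := by
  by_cases hD15 : 15 ≤ D
  · rw [srcBoundConst_of_le hD15]
    refine le_trans ?_ (le_srcConst hD15 hd)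
    gcongr
    linarith
  · obtain rfl := eq_two_of_lt_fifteen hd hD (not_le.1 hD15)
    have hD9 : (9 : ℝ) ≤ D := by exact_mod_cast (by omega : 9 ≤ D)
    have h := le_srcConst (le_refl 15) hd
    rw [srcBoundConst, if_neg hD15]
    have h1 : (1.58 : ℝ) ≤ √((2 : ℕ) + 1 / 2) := Real.le_sqrt_of_sq_le (by norm_num)
    have h2 : √((2 : ℕ) : ℝ) ≤ 1.4143 := Real.sqrt_le_iff.2 ⟨by norm_num, by norm_num⟩
    norm_num at h h1 h2 ⊢
    linarith

theorem srcBoundConst_pos {D d : ℕ} (hd : 2 ≤ d) (hD : 2 * d ^ 2 < D) : 0 < srcBoundConst D d := by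
  refine lt_of_lt_of_le ?_ (le_srcBoundConst hd hD)
  have : (0 : ℝ) < d := by exact_mod_cast (by omega : 0 < d)
  positivity

theorem srcBoundConst_le {D d : ℕ} (hd : 2 ≤ d) :
    srcBoundConst D d ≤ 1 / 2 ^ (d - 2) / ballRatio (d - 1) := by
  by_cases hD15 : 15 ≤ D
  · rw [srcBoundConst_of_le hD15]
    exact srcConst_le hD15 hd
  · rw [srcBoundConst, if_neg hD15]
    have h15 : (D : ℝ) < 15 := by exact_mod_cast not_le.1 hD15
    have := srcConst_le (le_refl 15) hd
    linarith

end Admissible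

/-! ### Estimates for the two terms of the bound -/

section Estimates

/-- If the first term of the bound is at most one, then the number of points per dimension is
exponentially large in the dimension. -/
theorem half_le_log_of_term_le_one {d : ℕ} (hd : 2 ≤ d) {C ρ : ℝ} (hC : 0 < C)
    (hC' : C ≤ 1 / 2 ^ (d - 2) / ballRatio (d - 1)) (hρ : 1 ≤ ρ)
    (h : d * 2 ^ d / C * √ρ * Real.exp (-(C * √ρ)) ≤ 1) : (d : ℝ) / 2 ≤ Real.log ρ := by
  by_contra! hlog
  have hd' : (2 : ℝ) ≤ d := by exact_mod_cast hd
  have hρ0 : 0 < ρ := by linarith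
  have hρexp : ρ < Real.exp (d / 2) := (Real.log_lt_iff_lt_exp hρ0).1 hlog
  have hr := ballRatio_pos (d - 1)
  have hpi := Real.pi_gt_d2
  have hCsq : C ^ 2 ≤ 16 / 4 ^ d * ((d + 1) / (2 * Real.pi)) := by
    have h1 := le_ballRatio_sq (d - 1)
    have e1 : ((d - 1 : ℕ) : ℝ) + 2 = d + 1 := by
      rw [Nat.cast_sub (by omega)]; push_cast; ring
    rw [e1] at h1
    have h2 : C ^ 2 ≤ (1 / 2 ^ (d - 2) / ballRatio (d - 1)) ^ 2 := by gcongr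
    refine h2.trans ?_
    have e2 : (4 : ℝ) ^ d = 16 * (2 ^ (d - 2)) ^ 2 := by
      have : d = (d - 2) + 2 := by omega
      conv_lhs => rw [this]
      rw [pow_add, ← pow_mul, mul_comm _ 2, pow_mul]
      norm_num
      ring
    calc (1 / 2 ^ (d - 2) / ballRatio (d - 1)) ^ 2
        = 16 / 4 ^ d * (1 / ballRatio (d - 1) ^ 2) := by rw [e2]; field_simp
      _ ≤ 16 / 4 ^ d * (1 / (2 * Real.pi / (d + 1))) := by gcongr
      _ = _ := by rw [one_div_div]
  have hnat1 : ∀ d : ℕ, 2 ≤ d → ((d : ℝ) + 1) * 16 ≤ 3 * 4 ^ d := by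
    intro d hd
    induction d, hd using Nat.le_induction with
    | base => norm_num
    | succ d hd ih =>
      push_cast
      rw [pow_succ]
      have : (0 : ℝ) ≤ d := Nat.cast_nonneg d
      linarith
  -- For smaller `ρ` one has `C ≤ 1` and `C * √ρ ≤ 2`, so the term is at least `8 * exp (-2) > 1`.
  have hC1 : C ≤ 1 := by
    have : C ^ 2 ≤ 1 ^ 2 := by
      refine hCsq.trans ?_
      rw [div_mul_div_comm, one_pow, div_le_one (by positivity)]
      have := hnat1 d hd
      have h4 : (0 : ℝ) < 4 ^ d := by positivity
      nlinarith
    exact (sq_le_sq₀ hC.le one_pos.le).1 this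
  have hx : C * √ρ ≤ 2 := by
    refine (sq_le_sq₀ (by positivity) two_pos.le).1 ?_
    rw [mul_pow, Real.sq_sqrt hρ0.le]
    have he : Real.exp ((d : ℝ) / 2) ≤ 2 ^ d := by
      have e1 : Real.exp ((d : ℝ) / 2) = Real.exp (1 / 2) ^ d := by
        rw [← Real.exp_nat_mul]; ring_nf
      rw [e1]
      gcongr
      refine (sq_le_sq₀ (Real.exp_pos _).le two_pos.le).1 ?_
      rw [← Real.exp_nat_mul]
      norm_num
      linarith [Real.exp_one_lt_d9]
    have hnat2 : (d : ℝ) + 1 ≤ 2 ^ d := by exact_mod_cast Nat.lt_two_pow_self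
    have e4 : (4 : ℝ) ^ d = 2 ^ d * 2 ^ d := by rw [← mul_pow]; norm_num
    calc C ^ 2 * ρ ≤ 16 / 4 ^ d * ((d + 1) / (2 * Real.pi)) * 2 ^ d := by
          gcongr
          exact (hρexp.le).trans he
      _ ≤ 16 / 4 ^ d * (2 ^ d / (2 * Real.pi)) * 2 ^ d := by gcongr
      _ = 8 / Real.pi := by rw [e4]; field_simp; norm_num
      _ ≤ 2 ^ 2 := by
          rw [div_le_iff₀ Real.pi_pos]
          linarith
  have hbig : 1 < d * 2 ^ d / C * √ρ * Real.exp (-(C * √ρ)) := by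
    have hexp : Real.exp (-2) ≤ Real.exp (-(C * √ρ)) := Real.exp_le_exp.2 (by linarith)
    have hsq : 1 ≤ √ρ := Real.one_le_sqrt.2 hρ
    have h2d : (4 : ℝ) ≤ 2 ^ d := by
      calc (4 : ℝ) = 2 ^ 2 := by norm_num
        _ ≤ 2 ^ d := by gcongr; norm_num
    have h8 : (8 : ℝ) ≤ d * 2 ^ d / C := by
      rw [le_div_iff₀ hC]
      nlinarith
    have hexp2 : 1 < 8 * Real.exp (-2) := by
      rw [Real.exp_neg, ← div_eq_mul_inv, one_lt_div (Real.exp_pos _)]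
      have : Real.exp 2 = Real.exp 1 ^ 2 := by rw [← Real.exp_nat_mul]; norm_num
      rw [this]
      have h1 := Real.exp_one_lt_d9
      have h0 := Real.exp_pos 1
      nlinarith
    calc 1 < 8 * Real.exp (-2) := hexp2
      _ = 8 * 1 * Real.exp (-2) := by ring
      _ ≤ _ := by gcongr
  linarith

/-- The comparison of `ε^{D-d}` with the second term of the bound, for `ε^{d-1} = ρ^{-1/2}`, in
logarithmic form (`L = log ρ`). It uses `log x ≤ x / c + log c - 1` with `x = D / d`,
`c = 4 d`. -/
theorem log_estimate {d D L : ℝ} (hd : 2 ≤ d) (hD : 2 * d ^ 2 ≤ D) (hL : d / 2 ≤ L) :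
    -(D - d) * L / (2 * (d - 1)) + (D / (2 * d) - d + 1) * L ≤
      d * (Real.log 2 + 1) + d / 2 * Real.log (d / D) + (D - d) / 2 * Real.log ((D - d) / D) := by
  have hd0 : 0 < d := by linarith
  have hDd : d < D := by nlinarith
  have hD0 : 0 < D := by linarith
  have hDd0 : 0 < D - d := by linarith
  have h1 : -(d / 2) ≤ (D - d) / 2 * Real.log ((D - d) / D) := by
    have h := Real.one_sub_inv_le_log_of_pos (div_pos hDd0 hD0)
    rw [inv_div] at h
    calc -(d / 2) = (D - d) / 2 * (1 - D / (D - d)) := by field_simp; ring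
      _ ≤ _ := by gcongr
  have h2 : -(D / (8 * d)) - d * Real.log 2 - d / 2 * (d - 2) ≤ d / 2 * Real.log (d / D) := by
    have e1 : Real.log (d / D) = -(Real.log (D / (4 * d ^ 2)) + 2 * Real.log 2 + Real.log d) := by
      have e : d / D = (D / (4 * d ^ 2) * 2 ^ 2 * d)⁻¹ := by field_simp; norm_num
      rw [e, Real.log_inv, Real.log_mul (by positivity) (by positivity),
        Real.log_mul (by positivity) (by positivity), Real.log_pow]
      push_cast; ring
    have h3 := Real.log_le_sub_one_of_pos (show 0 < D / (4 * d ^ 2) by positivity)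
    have h4 := Real.log_le_sub_one_of_pos hd0
    rw [e1]
    calc -(D / (8 * d)) - d * Real.log 2 - d / 2 * (d - 2)
        = d / 2 * -((D / (4 * d ^ 2) - 1) + 2 * Real.log 2 + (d - 1)) := by field_simp; ring
      _ ≤ _ := by gcongr
  have hM : -(D - d) * L / (2 * (d - 1)) + (D / (2 * d) - d + 1) * L =
      -(L * ((D - d ^ 2) / (2 * d * (d - 1)) + (d - 1))) := by
    have : d - 1 ≠ 0 := by linarith
    field_simp
    ring
  have hd1 : 0 < d - 1 := by linarith
  have hM2 : d / 2 * ((D - d ^ 2) / (2 * d * (d - 1)) + (d - 1)) ≤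
      L * ((D - d ^ 2) / (2 * d * (d - 1)) + (d - 1)) := by
    have : 0 ≤ D - d ^ 2 := by nlinarith
    gcongr
  have hM3 : D / (8 * d) + d / 2 * (d - 1) ≤
      d / 2 * ((D - d ^ 2) / (2 * d * (d - 1)) + (d - 1)) := by
    have h5 : D / (8 * d) ≤ (D - d ^ 2) / (4 * (d - 1)) := by
      rw [div_le_div_iff₀ (by positivity) (by positivity)]
      nlinarith
    calc _ ≤ (D - d ^ 2) / (4 * (d - 1)) + d / 2 * (d - 1) := by gcongr
      _ = _ := by field_simp; ring
  rw [hM]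
  nlinarith

theorem capBound_eq (d : ℕ) (α : ℝ) : capBound d α =
    2 / (d * ballRatio (d - 1)) * (Real.sin α ^ (d - 1) * Real.cos α) := by
  rcases Nat.eq_zero_or_pos d with rfl | hd
  · simp [capBound]
  obtain ⟨e, rfl⟩ : ∃ e, d = e + 1 := ⟨d - 1, by omega⟩
  have := unitBallVol_pos e
  have := unitBallVol_pos (e + 1)
  simp only [capBound, ballRatio, Nat.add_sub_cancel]
  field_simp

/-- The flat cone loses a factor `cos α`, which is recovered from
`sin (2 * α) = 2 * sin α * cos α`. -/
theorem le_capBound {d : ℕ} (hd : 2 ≤ d) {α δ : ℝ} (h0 : 0 < α) (h1 : α < Real.pi / 4)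
    (hδ : 0 ≤ δ) (h : 2 * δ ≤ Real.sin (2 * α)) :
    2 / (d * ballRatio (d - 1)) * δ ^ (d - 1) ≤ capBound d α := by
  have hpi := Real.pi_pos
  have hr := ballRatio_pos (d - 1)
  have hs : 0 < Real.sin α := Real.sin_pos_of_pos_of_lt_pi h0 (by linarith)
  have hc : 0 < Real.cos α := Real.cos_pos_of_mem_Ioo ⟨by linarith, by linarith⟩
  rw [Real.sin_two_mul] at h
  rw [capBound_eq]
  gcongr
  calc δ ^ (d - 1) ≤ (Real.sin α * Real.cos α) ^ (d - 1) := by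
        gcongr; linarith
    _ = Real.sin α ^ (d - 1) * Real.cos α ^ (d - 1) := mul_pow _ _ _
    _ ≤ _ := by
        gcongr
        exact pow_le_of_le_one hc.le (Real.cos_le_one _) (by omega)

/-- The choice of the angle `θ` with `sin θ = ρ^{-1/(2(d-1))}`: it makes the two failure
probabilities at most one half of the first term of the bound, and the share of one atom in the
second term. -/
theorem exists_angle {d D s : ℕ} (hd : 2 ≤ d) (hD : 2 * d ^ 2 < D) {C ρ k : ℝ} (hC : 0 < C)
    (hC' : C ≤ 1 / 2 ^ (d - 2) / ballRatio (d - 1)) (hρ : 1 ≤ ρ) (hs : (s : ℝ) = d * ρ)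
    (hk : k = D / (2 * d) - d)
    (h : d * 2 ^ d / C * √ρ * Real.exp (-(C * √ρ)) ≤ 1) :
    ∃ θ : ℝ, 0 < θ ∧ θ < Real.pi / 2 ∧ 0 < capBound d (θ / 4) ∧
      Real.exp (-capBound d (θ / 2)) ^ s ≤
        capBound d (θ / 4) * (d * 2 ^ d / C * √ρ * Real.exp (-(C * √ρ)) / 2) ∧
      Real.sin θ ^ (D - d) * ρ ^ (k + 1) ≤ (2 * Real.exp 1) ^ d *
        (√((d : ℝ) / D) ^ d * √(((D - d : ℕ) : ℝ) / D) ^ (D - d)) := by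
  have hpi := Real.pi_pos
  have hL := half_le_log_of_term_le_one hd hC hC' hρ h
  have hd' : (2 : ℝ) ≤ d := by exact_mod_cast hd
  have hρ0 : 0 < ρ := by linarith
  have hL0 : 0 < Real.log ρ := by linarith
  have hr := ballRatio_pos (d - 1)
  have hsq : 0 < √ρ := Real.sqrt_pos.2 hρ0
  set ε := Real.exp (-(Real.log ρ / (2 * (d - 1)))) with hε
  have hε0 : 0 < ε := Real.exp_pos _
  have hε1 : ε < 1 := by
    rw [hε, Real.exp_lt_one_iff, neg_lt_zero]
    exact div_pos hL0 (by linarith)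
  have hd1 : ((d - 1 : ℕ) : ℝ) = d - 1 := by rw [Nat.cast_sub (by omega)]; simp
  have hεd : ε ^ (d - 1) = 1 / √ρ := by
    have hne : (d : ℝ) - 1 ≠ 0 := by linarith
    rw [hε, ← Real.exp_nat_mul, hd1, one_div, ← Real.exp_log hsq, ← Real.exp_neg,
      Real.log_sqrt hρ0.le]
    congr 1
    field_simp
  set θ := Real.arcsin ε with hθ
  have hθ0 : 0 < θ := Real.arcsin_pos.2 hε0
  have hθ1 : θ < Real.pi / 2 := Real.arcsin_lt_pi_div_two.2 hε1
  have hsin : Real.sin θ = ε := Real.sin_arcsin (by linarith) hε1.le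
  have hsin2 : ε / 2 ≤ Real.sin (θ / 2) := by
    have e : Real.sin θ = 2 * Real.sin (θ / 2) * Real.cos (θ / 2) := by
      rw [← Real.sin_two_mul]; ring_nf
    have h1 := Real.cos_le_one (θ / 2)
    have h2 := Real.sin_pos_of_pos_of_lt_pi (half_pos hθ0) (by linarith)
    rw [hsin] at e
    nlinarith
  have hcap2 := le_capBound hd (α := θ / 2) (δ := ε / 2) (by linarith) (by linarith) (by linarith)
    (by rw [mul_div_cancel₀ θ two_ne_zero, hsin]; linarith)
  have hcap4 := le_capBound hd (α := θ / 4) (δ := ε / 4) (by linarith) (by linarith) (by linarith)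
    (by
      have : 2 * (θ / 4) = θ / 2 := by ring
      rw [this]; linarith)
  have hpow2 : (2 : ℝ) ^ d = 4 * 2 ^ (d - 2) := by
    have : d = (d - 2) + 2 := by omega
    conv_lhs => rw [this]
    rw [pow_add]; ring
  have hpow1 : (2 : ℝ) ^ (d - 1) = 2 * 2 ^ (d - 2) := by
    have : d - 1 = (d - 2) + 1 := by omega
    rw [this, pow_succ]; ring
  set C' := 1 / 2 ^ (d - 2) / ballRatio (d - 1) with hC'def
  have e2 : 2 / (d * ballRatio (d - 1)) * (ε / 2) ^ (d - 1) = C' / (d * √ρ) := by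
    rw [div_pow, hεd, hpow1, hC'def]; field_simp
  have e4 : 2 / (d * ballRatio (d - 1)) * (ε / 4) ^ (d - 1) = 2 * C' / (d * √ρ * 2 ^ d) := by
    have h4 : (4 : ℝ) ^ (d - 1) = 2 ^ (d - 1) * 2 ^ (d - 1) := by rw [← mul_pow]; norm_num
    rw [div_pow, hεd, h4, hpow1, hpow2, hC'def]; field_simp; norm_num
  rw [e2] at hcap2
  rw [e4] at hcap4
  have hC'0 : 0 < C' := hC.trans_le hC'
  refine ⟨θ, hθ0, hθ1, lt_of_lt_of_le (by positivity) hcap4, ?_, ?_⟩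
  · rw [← Real.exp_nat_mul, hs]
    have hexp : C * √ρ ≤ d * ρ * capBound d (θ / 2) := by
      calc C * √ρ ≤ C' * √ρ := by gcongr
        _ = d * ρ * (C' / (d * √ρ)) := by
          nth_rw 2 [← Real.mul_self_sqrt hρ0.le]
          field_simp
        _ ≤ _ := by gcongr
    calc Real.exp (d * ρ * -capBound d (θ / 2)) ≤ Real.exp (-(C * √ρ)) := by
          rw [Real.exp_le_exp]; linarith
      _ = 2 * C / (d * √ρ * 2 ^ d) * (d * 2 ^ d / C * √ρ * Real.exp (-(C * √ρ)) / 2) := by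
          field_simp
      _ ≤ _ := by
          gcongr
          refine le_trans ?_ hcap4
          gcongr
  · have hdD : d < D := by nlinarith
    have hD0 : (0 : ℝ) < D := by exact_mod_cast (by omega : 0 < D)
    have hdDr : (d : ℝ) < D := by exact_mod_cast hdD
    have hDd : ((D - d : ℕ) : ℝ) = D - d := by rw [Nat.cast_sub hdD.le]
    have hest := log_estimate hd' (by exact_mod_cast hD.le : 2 * (d : ℝ) ^ 2 ≤ D) hL
    have hsqrt : ∀ (x : ℝ) (m : ℕ), 0 < x → √x ^ m = Real.exp (m / 2 * Real.log x) := by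
      intro x m hx
      rw [Real.sqrt_eq_rpow, ← Real.rpow_natCast, ← Real.rpow_mul hx.le, Real.rpow_def_of_pos hx]
      congr 1; ring
    have h2e : (2 * Real.exp 1) ^ d = Real.exp (d * (Real.log 2 + 1)) := by
      rw [Real.exp_nat_mul, Real.exp_add, Real.exp_log two_pos]
    rw [hsin, hε, ← Real.exp_nat_mul, Real.rpow_def_of_pos hρ0, ← Real.exp_add, h2e,
      hsqrt _ _ (div_pos (by linarith) hD0), hsqrt _ _ (div_pos (by rw [hDd]; linarith) hD0),
      ← Real.exp_add, ← Real.exp_add, Real.exp_le_exp, hDd, hk]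
    calc _ = -((D : ℝ) - d) * Real.log ρ / (2 * (d - 1)) +
          (D / (2 * d) - d + 1) * Real.log ρ := by ring
      _ ≤ _ := hest
      _ = _ := by ring

end Estimates

/-! ### The union bound -/

section UnionBound

variable {D : ℕ} {Ω : Type*} [MeasurableSpace Ω] {P : Measure Ω}

/-- A random subspace and an independent random unit vector make a small angle with at most the
probability for a fixed unit vector. -/
theorem measure_le_norm_starProjection_le_of_indepFun [IsProbabilityMeasure P]
    {X : Ω → Submodule ℝ (EuclideanSpace ℝ (Fin D))} {Y : Ω → EuclideanSpace ℝ (Fin D)}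
    (hX : Measurable X) (hY : Measurable Y) (hXY : IndepFun X Y P) (hY1 : ∀ᵐ ω ∂P, ‖Y ω‖ = 1)
    {t : ℝ} {A b : ENNReal}
    (h : ∀ y, ‖y‖ = 1 → A * (P.map X) {S | t ≤ ‖S.starProjection y‖} ≤ b) :
    A * P {ω | t ≤ ‖(X ω).starProjection (Y ω)‖} ≤ b := by
  have := Measure.isProbabilityMeasure_map (μ := P) hX.aemeasurable
  have := Measure.isProbabilityMeasure_map (μ := P) hY.aemeasurable
  set H : Set (Submodule ℝ (EuclideanSpace ℝ (Fin D)) × EuclideanSpace ℝ (Fin D)) :=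
    {p | t ≤ ‖p.1.starProjection p.2‖} with hH
  have hHm : MeasurableSet H := measurableSet_le measurable_const measurable_starProjection_apply.norm
  have h1 : P {ω | t ≤ ‖(X ω).starProjection (Y ω)‖} = ((P.map X).prod (P.map Y)) H := by
    rw [← (indepFun_iff_map_prod_eq_prod_map_map hX.aemeasurable hY.aemeasurable).1 hXY,
      Measure.map_apply (hX.prodMk hY) hHm]
    rfl
  rw [h1, Measure.prod_apply_symm hHm,
    ← lintegral_const_mul _ (measurable_measure_prodMk_right hHm)]
  have hY1' : ∀ᵐ y ∂(P.map Y), ‖y‖ = 1 :=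
    (ae_map_iff hY.aemeasurable (isClosed_eq continuous_norm continuous_const).measurableSet).2 hY1
  calc _ ≤ ∫⁻ _, b ∂(P.map Y) := by
        refine lintegral_mono_ae ?_
        filter_upwards [hY1'] with y hy
        exact h y hy
    _ = b := by simp

variable {n : ℕ} {d s : Fin n → ℕ} {S : Fin n → Ω → Submodule ℝ (EuclideanSpace ℝ (Fin D))}
  {a : (i : Fin n) → Fin (s i) → Ω → EuclideanSpace ℝ (Fin D)}

theorem IsRandomSubspaceModel.isSphereSample (hM : IsRandomSubspaceModel d s P S a) (i : Fin n) :
    IsSphereSample P (S i) (a i) :=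
  hM.uniform_points i

theorem IsRandomSubspaceModel.ae_finrank_eq (hM : IsRandomSubspaceModel d s P S a) (i : Fin n) :
    ∀ᵐ ω ∂P, Module.finrank ℝ (S i ω) = d i :=
  ae_of_ae_map (hM.measurable_subspace i).aemeasurable (hM.uniform_subspace i).finrank_eq

/-- The probability of a bad direction in the `i`-th subspace. -/
theorem IsRandomSubspaceModel.measureReal_exists_direction_le [IsProbabilityMeasure P]
    (hM : IsRandomSubspaceModel d s P S a) (i : Fin n) (hd : 2 ≤ d i) (hs : 0 < s i) {θ T : ℝ}
    (h0 : 0 < θ) (h1 : θ < Real.pi / 2) (hcap : 0 < capBound (d i) (θ / 4))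
    (hT : Real.exp (-capBound (d i) (θ / 2)) ^ s i ≤ capBound (d i) (θ / 4) * T) :
    P.real {ω | ∃ w ∈ S i ω, ‖w‖ = 1 ∧ ∀ j, |inner ℝ (a i j ω) w| < Real.cos θ} ≤ T := by
  have h := (hM.isSphereSample i).measure_exists_direction_le (hM.measurable_subspace i)
    (hM.measurable_point i) hs hd (hM.ae_finrank_eq i) (α := θ / 2) (β := 3 / 4 * θ) (γ := θ / 4)
    (by linarith) (by linarith) (by linarith) (by linarith)
  have e : 3 / 4 * θ + θ / 4 = θ := by ring
  rw [e] at h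
  set σ := capBound (d i) (θ / 2)
  have hexp : (1 : ENNReal) - ENNReal.ofReal σ ≤ ENNReal.ofReal (Real.exp (-σ)) := by
    rw [tsub_le_iff_right, ← ENNReal.ofReal_one]
    refine le_trans (ENNReal.ofReal_le_ofReal ?_) ENNReal.ofReal_add_le
    linarith [Real.add_one_le_exp (-σ)]
  have h2 : ENNReal.ofReal (capBound (d i) (θ / 4)) *
      P {ω | ∃ w ∈ S i ω, ‖w‖ = 1 ∧ ∀ j, |inner ℝ (a i j ω) w| < Real.cos θ} ≤
      ENNReal.ofReal (capBound (d i) (θ / 4) * T) := by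
    refine h.trans ((pow_le_pow_left' hexp _).trans ?_)
    rw [← ENNReal.ofReal_pow (Real.exp_pos _).le]
    exact ENNReal.ofReal_le_ofReal hT
  rw [ENNReal.ofReal_mul hcap.le, ENNReal.mul_le_mul_iff_right
    (ENNReal.ofReal_pos.2 hcap).ne' ENNReal.ofReal_ne_top] at h2
  have hT0 : 0 ≤ T := by
    have : 0 < Real.exp (-σ) ^ s i := by positivity
    exact (pos_of_mul_pos_right (this.trans_le hT) hcap.le).le
  exact ENNReal.toReal_le_of_le_ofReal hT0 h2

/-- The probability that an atom of another group makes an angle of at most `θ` with the `i`-th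
subspace. -/
theorem IsRandomSubspaceModel.measureReal_le_norm_starProjection_le [IsProbabilityMeasure P]
    (hM : IsRandomSubspaceModel d s P S a) {i j : Fin n} (hij : j ≠ i) (l : Fin (s j))
    (hd : 0 < d i) (hdD : d i < D) {θ T : ℝ} (h0 : 0 < θ) (h1 : θ < Real.pi / 2)
    (hT : Real.sin θ ^ (D - d i) ≤ T *
      (√((d i : ℝ) / D) ^ d i * √(((D - d i : ℕ) : ℝ) / D) ^ (D - d i))) :
    P.real {ω | Real.cos θ ≤ ‖(S i ω).starProjection (a j l ω)‖} ≤ T := by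
  have hcos : 0 ≤ Real.cos θ := Real.cos_nonneg_of_mem_Icc ⟨by linarith, h1.le⟩
  have hsin : 0 < Real.sin θ := Real.sin_pos_of_pos_of_lt_pi h0 (by linarith [Real.pi_pos])
  have hindep : IndepFun (S i) (a j l) P :=
    (hM.indep.indepFun hij.symm).comp measurable_fst ((measurable_pi_apply l).comp measurable_snd)
  have h := measure_le_norm_starProjection_le_of_indepFun (hM.measurable_subspace i)
    (hM.measurable_point j l) hindep
    ((hM.isSphereSample j).ae_norm_eq_one (hM.measurable_subspace j) l) (t := Real.cos θ)
    fun y hy => (hM.uniform_subspace i).measure_le_norm_starProjection_le hd hdD hcos hsin.le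
      (Real.cos_sq_add_sin_sq θ) hy
  have hD0 : (0 : ℝ) < D := by exact_mod_cast (by omega : 0 < D)
  have hd0 : (0 : ℝ) < d i := by exact_mod_cast hd
  have hDd0 : (0 : ℝ) < (D - d i : ℕ) := by exact_mod_cast (by omega : 0 < D - d i)
  rw [← ENNReal.ofReal_pow (Real.sqrt_nonneg _), ← ENNReal.ofReal_pow (Real.sqrt_nonneg _),
    ← ENNReal.ofReal_mul (by positivity), ← ENNReal.ofReal_pow hsin.le] at h
  set A := √((d i : ℝ) / D) ^ d i * √(((D - d i : ℕ) : ℝ) / D) ^ (D - d i) with hA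
  have hA0 : 0 < A := by positivity
  have h2 := h.trans (ENNReal.ofReal_le_ofReal hT)
  rw [mul_comm T, ENNReal.ofReal_mul hA0.le, ENNReal.mul_le_mul_iff_right
    (ENNReal.ofReal_pos.2 hA0).ne' ENNReal.ofReal_ne_top] at h2
  have hT0 : 0 ≤ T := by
    have : 0 < Real.sin θ ^ (D - d i) := by positivity
    exact (pos_of_mul_pos_left (this.trans_le hT) hA0.le).le
  exact ENNReal.toReal_le_of_le_ofReal hT0 h2

/-- Outside the bad directions and the atoms close to a foreign subspace, classification is correct;
the union bound over these events. -/
theorem IsRandomSubspaceModel.exists_measurableSet_srcCorrect [IsProbabilityMeasure P]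
    (hM : IsRandomSubspaceModel d s P S a) (hs : ∀ i, 0 < s i) {θ T₁ T₂ : Fin n → ℝ}
    (h0 : ∀ i, 0 < θ i) (h1 : ∀ i, θ i < Real.pi / 2)
    (hT₁ : ∀ i, P.real {ω | ∃ w ∈ S i ω, ‖w‖ = 1 ∧
      ∀ j, |inner ℝ (a i j ω) w| < Real.cos (θ i)} ≤ T₁ i)
    (hT₂ : ∀ i j, j ≠ i → ∀ l : Fin (s j),
      P.real {ω | Real.cos (θ i) ≤ ‖(S i ω).starProjection (a j l ω)‖} ≤ T₂ i)
    (hT₂0 : ∀ i, 0 ≤ T₂ i) :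
    ∃ E : Set Ω, MeasurableSet E ∧
      (∀ ω ∈ E, SRCCorrect (fun i => S i ω) (fun q : Σ i, Fin (s i) => a q.1 q.2 ω)) ∧
      1 - ∑ i, (T₁ i + (∑ j, (s j : ℝ)) * T₂ i) ≤ P.real E := by
  set bad : Fin n → Set Ω := fun i =>
    {ω | ∃ w ∈ S i ω, ‖w‖ = 1 ∧ ∀ j, |inner ℝ (a i j ω) w| < Real.cos (θ i)} with hbad
  set near : Fin n → (Σ j, Fin (s j)) → Set Ω := fun i q =>
    {ω | q.1 ≠ i ∧ Real.cos (θ i) ≤ ‖(S i ω).starProjection (a q.1 q.2 ω)‖} with hnear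
  set N : Set Ω := {ω | ¬ ∀ q : Σ j, Fin (s j), a q.1 q.2 ω ∈ S q.1 ω} with hN
  set F : Set Ω := N ∪ ⋃ i, (bad i ∪ ⋃ q, near i q) with hF
  have hN0 : P N = 0 := ae_iff.1 (ae_all_iff.2 fun q : Σ j, Fin (s j) =>
    (hM.isSphereSample q.1).ae_mem (hM.measurable_subspace q.1) q.2)
  have hPF : P.real F ≤ ∑ i, (T₁ i + (∑ j, (s j : ℝ)) * T₂ i) := by
    refine (measureReal_union_le _ _).trans ?_
    have : P.real N = 0 := by rw [measureReal_def, hN0, ENNReal.toReal_zero]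
    rw [this, zero_add]
    refine (measureReal_iUnion_fintype_le _).trans (Finset.sum_le_sum fun i _ => ?_)
    refine (measureReal_union_le _ _).trans (add_le_add (hT₁ i) ?_)
    refine (measureReal_iUnion_fintype_le _).trans ?_
    calc ∑ q, P.real (near i q) ≤ ∑ _q : Σ j, Fin (s j), T₂ i := by
          refine Finset.sum_le_sum fun q _ => ?_
          by_cases hq : q.1 = i
          · have : near i q = ∅ := by
              ext ω
              simp [hnear, hq]
            rw [this, measureReal_empty]
            exact hT₂0 i
          · exact (measureReal_mono fun ω hω => hω.2).trans (hT₂ i q.1 hq q.2)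
      _ = _ := by simp
  refine ⟨(toMeasurable P F)ᶜ, (measurableSet_toMeasurable P F).compl, fun ω hω => ?_, ?_⟩
  · have hω' : ω ∉ F := fun h => hω (subset_toMeasurable P F h)
    simp only [hF, Set.mem_union, Set.mem_iUnion, not_or, not_exists] at hω'
    obtain ⟨hωN, hωF⟩ := hω'
    have hcos : ∀ i, 0 < Real.cos (θ i) := fun i =>
      Real.cos_pos_of_mem_Ioo ⟨by linarith [h0 i, Real.pi_pos], h1 i⟩
    refine srcCorrect_of_inradius (t := fun i => Real.cos (θ i)) hcos (fun i w hw => ?_)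
      (not_not.1 hωN) (fun i q hq => not_le.1 fun hle => (hωF i).2 q ⟨hq, hle⟩)
    rcases eq_or_ne w 0 with rfl | hw0
    · exact ⟨⟨0, hs i⟩, by simp⟩
    have hwn : 0 < ‖w‖ := norm_pos_iff.2 hw0
    by_contra! hcon
    refine (hωF i).1 ⟨‖w‖⁻¹ • w, (S i ω).smul_mem _ hw, ?_, fun j => ?_⟩
    · rw [norm_smul, norm_inv, norm_norm, inv_mul_cancel₀ hwn.ne']
    · rw [inner_smul_right, abs_mul, abs_of_pos (inv_pos.2 hwn), inv_mul_lt_iff₀ hwn, mul_comm]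
      exact hcon j
  · rw [measureReal_compl (measurableSet_toMeasurable P F), probReal_univ]
    have : P.real (toMeasurable P F) = P.real F := by
      rw [measureReal_def, measure_toMeasurable, measureReal_def]
    linarith

end UnionBound

/-! ### The probability of correct classification -/

theorem mainTheorem7 :
    ∃ C : ℕ → ℕ → ℝ,
      (∀ D D' e : ℕ, 2 ≤ e → 2 * e ^ 2 < D → D < D' → C D e < C D' e) ∧
      (∀ D e e' : ℕ, 2 ≤ e → e < e' → 2 * e' ^ 2 < D → C D e' < C D e) ∧
      (∀ D e : ℕ, 2 ≤ e → 2 * e ^ 2 < D →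
        0.79 * Real.sqrt (e : ℝ) / 2.07 ^ (e - 1) ≤ C D e) ∧
      (∀ D e : ℕ, 2 ≤ e → 2 * e ^ 2 < D → 15 ≤ D → C D e = srcConst D e) ∧
      ∀ (n D : ℕ) (_ : 1 ≤ n) (d s : Fin n → ℕ) (ρ p k : Fin n → ℝ)
        (_ : ∀ i, ρ i = (s i : ℝ) / (d i : ℝ))
        (_ : ∀ i, p i = (s i : ℝ) / ∑ j, (s j : ℝ))
        (_ : ∀ i, k i = (D : ℝ) / (2 * (d i : ℝ)) - (d i : ℝ))
        (_ : ∀ i, 2 ≤ d i) (_ : ∀ i, (d i : ℝ) < Real.sqrt ((D : ℝ) / 2)) (_ : ∀ i, 1 ≤ ρ i)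
        (Ω : Type*) [MeasurableSpace Ω] (P : Measure Ω) [IsProbabilityMeasure P]
        (S : Fin n → Ω → Submodule ℝ (EuclideanSpace ℝ (Fin D)))
        (a : (i : Fin n) → Fin (s i) → Ω → EuclideanSpace ℝ (Fin D))
        (_ : IsRandomSubspaceModel d s P S a),
        ∃ E : Set Ω, MeasurableSet E ∧
          (∀ ω ∈ E, SRCCorrect (fun i => S i ω) (fun q : Σ i, Fin (s i) => a q.1 q.2 ω)) ∧
          P.real E > 1 - ∑ i,
            ((d i : ℝ) * 2 ^ d i / C D (d i) * Real.sqrt (ρ i) *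
                Real.exp (-(C D (d i) * Real.sqrt (ρ i))) +
              (d i : ℝ) * (2 * Real.exp 1) ^ d i / (p i * ρ i ^ k i)) := by
  refine ⟨srcBoundConst, fun D D' e he _ h => srcBoundConst_strictMono he h,
    fun D e e' he h hD => srcBoundConst_strictAnti he h hD,
    fun D e he hD => le_srcBoundConst he hD, fun D e _ _ hD => srcBoundConst_of_le hD e, ?_⟩
  intro n D hn d s ρ p k hρ hp hk hd hdD hρ1 Ω _ P _ S a hM
  have hD : ∀ i, 2 * d i ^ 2 < D := by
    intro i
    have h := (Real.lt_sqrt (Nat.cast_nonneg _)).1 (hdD i)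
    have : 2 * (d i : ℝ) ^ 2 < D := by linarith
    exact_mod_cast this
  have hd0 : ∀ i, (0 : ℝ) < d i := fun i => by
    have := hd i
    exact_mod_cast (by omega : 0 < d i)
  have hρ0 : ∀ i, 0 < ρ i := fun i => one_pos.trans_le (hρ1 i)
  have hs' : ∀ i, (s i : ℝ) = d i * ρ i := fun i => by
    rw [hρ, mul_div_cancel₀ _ (hd0 i).ne']
  have hs0 : ∀ i, (0 : ℝ) < s i := fun i => by rw [hs']; exact mul_pos (hd0 i) (hρ0 i)
  have hs : ∀ i, 0 < s i := fun i => by exact_mod_cast hs0 i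
  set M : ℝ := ∑ j, (s j : ℝ) with hMdef
  have hM0 : 0 < M := Finset.sum_pos (fun j _ => hs0 j) ⟨⟨0, hn⟩, Finset.mem_univ _⟩
  have hp0 : ∀ i, 0 < p i := fun i => by rw [hp]; exact div_pos (hs0 i) hM0
  have hC : ∀ i, 0 < srcBoundConst D (d i) := fun i => srcBoundConst_pos (hd i) (hD i)
  set T₁ : Fin n → ℝ := fun i => (d i : ℝ) * 2 ^ d i / srcBoundConst D (d i) * √(ρ i) *
    Real.exp (-(srcBoundConst D (d i) * √(ρ i))) with hT₁
  set T₂ : Fin n → ℝ := fun i => (d i : ℝ) * (2 * Real.exp 1) ^ d i / (p i * ρ i ^ k i) with hT₂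
  have hT₁0 : ∀ i, 0 < T₁ i := fun i => by
    have := hC i; have := hd0 i; have := Real.sqrt_pos.2 (hρ0 i)
    positivity
  have hT₂0 : ∀ i, 0 < T₂ i := fun i => by
    have := hp0 i; have := hd0 i; have := Real.rpow_pos_of_pos (hρ0 i) (k i)
    positivity
  by_cases hsmall : ∀ i, T₁ i ≤ 1
  · choose θ hθ0 hθ1 hcap hexp hsin using fun i => exists_angle (hd i) (hD i) (hC i)
      (srcBoundConst_le (hd i)) (hρ1 i) (hs' i) (hk i) (hsmall i)
    have hMT : ∀ i, M * ((2 * Real.exp 1) ^ d i / ρ i ^ (k i + 1)) = T₂ i := by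
      intro i
      have hne := (hs0 i).ne'
      have h1 := (Real.rpow_pos_of_pos (hρ0 i) (k i)).ne'
      have h2 := (hρ0 i).ne'
      have h3 := (hd0 i).ne'
      have h4 := hM0.ne'
      simp only [hT₂]
      rw [hp, hs', Real.rpow_add_one h2]
      field_simp
    obtain ⟨E, hE, hsrc, hPE⟩ := hM.exists_measurableSet_srcCorrect hs hθ0 hθ1
      (fun i => hM.measureReal_exists_direction_le i (hd i) (hs i) (hθ0 i) (hθ1 i) (hcap i)
        (hexp i))
      (T₂ := fun i => (2 * Real.exp 1) ^ d i / ρ i ^ (k i + 1))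
      (fun i j hji l => hM.measureReal_le_norm_starProjection_le hji l
        (by have := hd i; omega) (by have := hd i; have := hD i; nlinarith) (hθ0 i) (hθ1 i) (by
          rw [div_mul_eq_mul_div, le_div_iff₀ (Real.rpow_pos_of_pos (hρ0 i) _)]
          exact hsin i))
      (fun i => by have := Real.rpow_pos_of_pos (hρ0 i) (k i + 1); positivity)
    refine ⟨E, hE, hsrc, lt_of_lt_of_le ?_ hPE⟩
    refine sub_lt_sub_left (Finset.sum_lt_sum_of_nonempty ⟨⟨0, hn⟩, Finset.mem_univ _⟩
      fun i _ => ?_) _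
    rw [hMT]
    have := hT₁0 i
    change T₁ i / 2 + T₂ i < T₁ i + T₂ i
    linarith
  · -- A term exceeding one makes the claimed lower bound negative.
    push Not at hsmall
    obtain ⟨i, hi⟩ := hsmall
    refine ⟨∅, MeasurableSet.empty, by simp, ?_⟩
    have h1 : T₁ i + T₂ i ≤ ∑ i, (T₁ i + T₂ i) :=
      Finset.single_le_sum (f := fun i => T₁ i + T₂ i)
        (fun j _ => (add_pos (hT₁0 j) (hT₂0 j)).le) (Finset.mem_univ i)
    rw [measureReal_empty]
    change 0 > 1 - ∑ i, (T₁ i + T₂ i)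
    linarith [hT₂0 i]
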